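/- Let $G$ be a finite Frobenius group with Frobenius complement $H$, i.e. $H$ is a proper non-trivial subgroup of $G$ with $H\cap gHg^{-1}=\{e\}$ for all $g\in G\setminus H$, and let $K=\bigl(G\setminus\bigcup_{g\in G}gHg^{-1}\bigr)\cup\{e\}$ be its Frobenius kernel, so that $G=K\rtimes H$. Assume that $K$ and $H$ are abelian, and let $k=|K|$ and $h=|H|$. Let $ZL^1(G)$ be the centre of the convolution algebra $L^1(G)$, with the $L^1$-norm, and let $ZA(G)$ be the algebra of class functions on $G$ under the pointwise product, with the norm of the Fourier algebra $A(G)$, that is $$\|u\|_{A(G)}=\sup\Bigl\{\Bigl|\sum_{x\in G}f(x)u(x)\Bigr| : f\colon G\to\mathbb{C},\ \|\lambda(f)\|\le 1\Bigr\},$$ where $\lambda(f)=\sum_{x} f(x)\lambda(x)$ acts on $\ell^2(G)$ by the left regular representation $\lambda$. For a Banach algebra $\mathcal{A}$ let the amenability constant $AM(\mathcal{A})\in[0,\infty]$ be the infimum of $\sup_\alpha\|\omega_\alpha\|$ over all bounded approximate diagonals of $\mathcal{A}$, i.e. bounded nets $(\omega_\alpha)$ in the projective tensor product $\mathcal{A}\hat\otimes\mathcal{A}$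 with $a\cdot\omega_\alpha-\omega_\alpha\cdot a\to0$ and $a\,m(\omega_\alpha)\to a$ for all $a\in\mathcal{A}$, where $a\cdot(b\otimes c)=ab\otimes c$, $(b\otimes c)\cdot a=b\otimes ca$ and $m(b\otimes c)=bc$ ($AM(\mathcal{A})=\infty$ if there are none). Then $$AM(ZA(G))=AM(ZL^1(G))=1+\frac{2(h^2-1)}{h}\left(1-\frac{h-1}{k}\right)\left(1-\frac1k\right).$$ -/

import Mathlib

open scoped TensorProduct ENNReal Topology

universe u

/-! ### Amenability constants -/

section Amenability

variable {A : Type u} [NonUnitalNormedRing A] [NormedSpace ℂ A]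

/-- The projective tensor norm on `A ⊗ A`: the infimum of `∑ ‖aᵢ‖ ‖bᵢ‖` over all representations
`u = ∑ aᵢ ⊗ bᵢ`. -/
noncomputable def projectiveNorm (u : A ⊗[ℂ] A) : ℝ :=
  sInf {r : ℝ | ∃ (n : ℕ) (a b : Fin n → A),
    u = ∑ i, a i ⊗ₜ[ℂ] b i ∧ r = ∑ i, ‖a i‖ * ‖b i‖}

variable [IsScalarTower ℂ A A] [SMulCommClass ℂ A A]

/-- The left module action `a · (b ⊗ c) = (a b) ⊗ c`. -/
noncomputable def tensorLeftAct (a : A) : A ⊗[ℂ] A →ₗ[ℂ] A ⊗[ℂ] A :=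
  LinearMap.rTensor A (LinearMap.mulLeft ℂ a)

/-- The right module action `(b ⊗ c) · a = b ⊗ (c a)`. -/
noncomputable def tensorRightAct (a : A) : A ⊗[ℂ] A →ₗ[ℂ] A ⊗[ℂ] A :=
  LinearMap.lTensor A (LinearMap.mulRight ℂ a)

/-- `ω` is a bounded approximate diagonal for the finite-dimensional Banach algebra `A`: a bounded
net in `A ⊗ A` with `a · ω_α - ω_α · a → 0` and `a m(ω_α) → a` for every `a`. For
finite-dimensional `A` the algebraic tensor product is complete in the projective norm, so that it
is the projective tensor product. -/
structure IsBoundedApproxDiagonal [FiniteDimensional ℂ A] {ι : Type*} [Preorder ι]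
    (ω : ι → A ⊗[ℂ] A) : Prop where
  bounded : ∃ C : ℝ, ∀ α, projectiveNorm (ω α) ≤ C
  tendsto_comm : ∀ a : A, Filter.Tendsto
    (fun α => projectiveNorm (tensorLeftAct a (ω α) - tensorRightAct a (ω α))) Filter.atTop (𝓝 0)
  tendsto_mul : ∀ a : A, Filter.Tendsto
    (fun α => a * LinearMap.mul' ℂ A (ω α)) Filter.atTop (𝓝 a)

variable (A) in
/-- The amenability constant of a finite-dimensional Banach algebra: the infimum of
`sup_α ‖ω_α‖` over all bounded approximate diagonals `(ω_α)`; it is `∞` if there is none. -/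
noncomputable def amenabilityConstant [FiniteDimensional ℂ A] : ℝ≥0∞ :=
  sInf {r : ℝ≥0∞ | ∃ (ι : Type u) (_ : Preorder ι) (_ : IsDirectedOrder ι) (_ : Nonempty ι)
    (ω : ι → A ⊗[ℂ] A), IsBoundedApproxDiagonal ω ∧
      r = ⨆ α, ENNReal.ofReal (projectiveNorm (ω α))}

end Amenability

/-! ### The group algebra `L¹(G)` and its centre -/

section GroupAlgebra

variable (G : Type u) [Group G] [Fintype G]

/-- The `L¹`-norm (for counting measure) on the group algebra of a finite group. -/
noncomputable def l1RingNorm : RingNorm (MonoidAlgebra ℂ G) where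
  toFun f := ∑ x, ‖f.coeff x‖
  map_zero' := by simp
  add_le' f g := by
    rw [← Finset.sum_add_distrib]
    exact Finset.sum_le_sum fun x _ => by simpa using norm_add_le (f.coeff x) (g.coeff x)
  neg' f := by simp
  mul_le' f g := by
    have h : ∀ x, (f * g).coeff x = ∑ y, f.coeff y * g.coeff (y⁻¹ * x) := fun x => by
      rw [MonoidAlgebra.coeff_mul_apply_left, Finsupp.sum_fintype _ _ (by simp)]
    calc ∑ x, ‖(f * g).coeff x‖
        ≤ ∑ x, ∑ y, ‖f.coeff y‖ * ‖g.coeff (y⁻¹ * x)‖ := Finset.sum_le_sum fun x _ => by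
          rw [h]
          exact (norm_sum_le _ _).trans (le_of_eq (by simp))
      _ = ∑ y, ‖f.coeff y‖ * ∑ x, ‖g.coeff x‖ := by
          rw [Finset.sum_comm]
          refine Finset.sum_congr rfl fun y _ => ?_
          rw [← Finset.mul_sum]
          congr 1
          exact Equiv.sum_comp (Equiv.mulLeft y⁻¹) fun x => ‖g.coeff x‖
      _ = _ := by rw [Finset.sum_mul]
  eq_zero_of_map_eq_zero' f hf := by
    rw [Finset.sum_eq_zero_iff_of_nonneg fun _ _ => norm_nonneg _] at hf
    apply MonoidAlgebra.coeff_injective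
    ext x
    simpa using hf x (Finset.mem_univ x)

/-- `L¹(G)` for a finite group `G`: functions `G → ℂ` under convolution, with the `L¹`-norm. -/
def L1 : Type u := MonoidAlgebra ℂ G

noncomputable instance : NormedRing (L1 G) := (l1RingNorm G).toNormedRing

noncomputable instance : Algebra ℂ (L1 G) := inferInstanceAs (Algebra ℂ (MonoidAlgebra ℂ G))

noncomputable instance : NormedAlgebra ℂ (L1 G) where
  norm_smul_le c f := by
    have h : ∀ p : MonoidAlgebra ℂ G, ∑ x, ‖(c • p).coeff x‖ ≤ ‖c‖ * ∑ x, ‖p.coeff x‖ :=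
      fun p => by simp [Finset.mul_sum]
    exact h f

noncomputable instance : FiniteDimensional ℂ (L1 G) :=
  Module.Finite.equiv (MonoidAlgebra.coeffLinearEquiv (S := ℂ) (M := G) ℂ).symm

/-- `ZL¹(G)`, the centre of `L¹(G)`. -/
noncomputable abbrev ZL1 : Subalgebra ℂ (L1 G) := Subalgebra.center ℂ (L1 G)

end GroupAlgebra

/-! ### The Fourier algebra `A(G)` and the central Fourier algebra -/

section FourierAlgebra

theorem opNorm_le_of_inner {X : Type u} [Fintype X] (T : EuclideanSpace ℂ X →L[ℂ] EuclideanSpace ℂ X) (C : ℝ) (hC : 0 ≤ C)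
    (h : ∀ ξ η, ‖inner ℂ η (T ξ)‖ ≤ C * (‖ξ‖ * ‖η‖)) : ‖T‖ ≤ C := by
  refine T.opNorm_le_bound hC fun ξ => ?_
  have h1 := h ξ (T ξ)
  rw [inner_self_eq_norm_sq_to_K] at h1
  simp only [norm_pow, RCLike.norm_ofReal, abs_norm] at h1
  rcases eq_or_ne ‖T ξ‖ 0 with h0 | h0
  · rw [h0]; positivity
  · have hpos : 0 < ‖T ξ‖ := lt_of_le_of_ne (norm_nonneg _) (Ne.symm h0)
    nlinarith

variable {G : Type u} [Group G] [Fintype G]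

/-- The operator `λ(f) = ∑ₜ f(t) λ(t)` on `ℓ²(G)`, where `(λ(t) ξ)(s) = ξ(t⁻¹ s)` is the left
regular representation. -/
noncomputable def leftRegularOp (f : G → ℂ) : EuclideanSpace ℂ G →L[ℂ] EuclideanSpace ℂ G :=
  LinearMap.toContinuousLinearMap
    { toFun := fun ξ => WithLp.toLp 2 fun s => ∑ t, f t * ξ (t⁻¹ * s)
      map_add' := fun ξ η => by ext s; simp [mul_add, Finset.sum_add_distrib]
      map_smul' := fun c ξ => by ext s; simp [Finset.mul_sum, mul_left_comm] }

/-- The norm of `A(G)` as the predual of the group von Neumann algebra, for a finite group `G`: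
`‖u‖ = sup {|∑ₓ f(x) u(x)| : ‖λ(f)‖ ≤ 1}`. -/
noncomputable def fourierNorm (u : G → ℂ) : ℝ :=
  ⨆ f : {f : G → ℂ // ‖leftRegularOp f‖ ≤ 1}, ‖∑ x, f.1 x * u x‖

theorem leftRegularOp_apply (f : G → ℂ) (ξ : EuclideanSpace ℂ G) (s : G) :
    leftRegularOp f ξ s = ∑ t, f t * ξ (t⁻¹ * s) := rfl

theorem leftRegularOp_smul (c : ℂ) (f : G → ℂ) : leftRegularOp (c • f) = c • leftRegularOp f := by
  ext ξ s
  simp [leftRegularOp_apply, Finset.mul_sum, mul_assoc]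

theorem norm_apply_le_leftRegularOp (f : G → ℂ) (x : G) : ‖f x‖ ≤ ‖leftRegularOp f‖ := by
  classical
  have h := (leftRegularOp f).le_opNorm (EuclideanSpace.single 1 1)
  have h2 := PiLp.norm_apply_le (leftRegularOp f (EuclideanSpace.single 1 1)) x
  have h3 : leftRegularOp f (EuclideanSpace.single 1 1) x = f x := by
    simp [leftRegularOp_apply, inv_mul_eq_one]
  rw [h3] at h2
  simpa using h2.trans h

theorem leftRegularOp_zero : leftRegularOp (0 : G → ℂ) = 0 := by
  ext ξ s
  simp [leftRegularOp_apply]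

theorem fourierNorm_bddAbove (u : G → ℂ) :
    BddAbove (Set.range fun f : {f : G → ℂ // ‖leftRegularOp f‖ ≤ 1} =>
      ‖∑ x, f.1 x * u x‖) := by
  refine ⟨∑ x, ‖u x‖, ?_⟩
  rintro _ ⟨f, rfl⟩
  refine (norm_sum_le _ _).trans (Finset.sum_le_sum fun x _ => ?_)
  rw [norm_mul]
  exact mul_le_of_le_one_left (norm_nonneg _) ((norm_apply_le_leftRegularOp f.1 x).trans f.2)

theorem fourierNorm_nonneg (u : G → ℂ) : 0 ≤ fourierNorm u :=
  Real.iSup_nonneg fun _ => norm_nonneg _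

theorem norm_pairing_le (f u : G → ℂ) :
    ‖∑ x, f x * u x‖ ≤ ‖leftRegularOp f‖ * fourierNorm u := by
  rcases eq_or_ne ‖leftRegularOp f‖ 0 with h0 | h0
  · have hf : ∀ x, f x = 0 := fun x => by
      have := norm_apply_le_leftRegularOp f x
      rw [h0] at this
      simpa using this
    simp [hf, h0]
  · have hpos : 0 < ‖leftRegularOp f‖ := lt_of_le_of_ne (norm_nonneg _) (Ne.symm h0)
    have h1 : ‖leftRegularOp (((‖leftRegularOp f‖ : ℂ)⁻¹) • f)‖ ≤ 1 := by
      rw [leftRegularOp_smul, norm_smul]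
      simp [h0]
    have h2 : ‖∑ x, (((‖leftRegularOp f‖ : ℂ)⁻¹) • f) x * u x‖ ≤ fourierNorm u :=
      le_ciSup (fourierNorm_bddAbove u) ⟨_, h1⟩
    simp only [Pi.smul_apply, smul_eq_mul, mul_assoc, ← Finset.mul_sum] at h2
    rw [norm_mul, norm_inv, Complex.norm_real, norm_norm] at h2
    rwa [inv_mul_le_iff₀ hpos] at h2

theorem inner_leftRegularOp (f : G → ℂ) (ξ η : EuclideanSpace ℂ G) :
    inner ℂ η (leftRegularOp f ξ) = ∑ x, f x * ∑ s, ξ (x⁻¹ * s) * star (η s) := by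
  simp only [PiLp.inner_apply, RCLike.inner_apply, leftRegularOp_apply, Finset.sum_mul,
    Finset.mul_sum]
  rw [Finset.sum_comm]
  simp [mul_assoc]

/-- Multiplying `f` by a coefficient function of the regular representation. -/
theorem norm_leftRegularOp_mul_coefficient (f : G → ℂ) (ξ η : EuclideanSpace ℂ G) :
    ‖leftRegularOp fun x => f x * ∑ s, ξ (x⁻¹ * s) * star (η s)‖ ≤
      ‖leftRegularOp f‖ * (‖ξ‖ * ‖η‖) := by
  refine opNorm_le_of_inner _ _ (by positivity) fun a b => ?_
  let p : EuclideanSpace ℂ G → EuclideanSpace ℂ G → G → EuclideanSpace ℂ G :=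
    fun ξ a r => WithLp.toLp 2 fun s => ξ s * a (s * r)
  have hp : ∀ ξ a : EuclideanSpace ℂ G, ∑ r, ‖p ξ a r‖ ^ 2 = ‖ξ‖ ^ 2 * ‖a‖ ^ 2 := by
    intro ξ a
    simp only [EuclideanSpace.norm_sq_eq, p, norm_mul, mul_pow]
    rw [Finset.sum_comm, Finset.sum_mul]
    refine Finset.sum_congr rfl fun s _ => ?_
    rw [← Finset.mul_sum]
    congr 1
    exact Equiv.sum_comp (Equiv.mulLeft s) fun t => ‖a t‖ ^ 2
  have hkey : inner ℂ b
      (leftRegularOp (fun x => f x * ∑ s, ξ (x⁻¹ * s) * star (η s)) a) =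
      ∑ r, inner ℂ (p η b r) (leftRegularOp f (p ξ a r)) := by
    simp only [inner_leftRegularOp, p]
    rw [Finset.sum_comm]
    refine Finset.sum_congr rfl fun x _ => ?_
    rw [← Finset.mul_sum, mul_assoc]
    congr 1
    rw [Finset.sum_mul, Finset.sum_comm]
    refine Finset.sum_congr rfl fun s _ => ?_
    rw [← Equiv.sum_comp (Equiv.mulLeft s), Finset.mul_sum]
    refine Finset.sum_congr rfl fun r _ => ?_
    simp only [Equiv.coe_mulLeft, star_mul', mul_assoc]
    ring
  rw [hkey]
  have hcs : ∑ r, ‖p ξ a r‖ * ‖p η b r‖ ≤ (‖ξ‖ * ‖a‖) * (‖η‖ * ‖b‖) := by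
    refine abs_le_of_sq_le_sq' ?_ (by positivity) |>.2
    calc _ ≤ (∑ r, ‖p ξ a r‖ ^ 2) * ∑ r, ‖p η b r‖ ^ 2 :=
          Finset.sum_mul_sq_le_sq_mul_sq _ _ _
      _ = _ := by rw [hp, hp]; ring
  calc ‖∑ r, inner ℂ (p η b r) (leftRegularOp f (p ξ a r))‖
      ≤ ∑ r, ‖leftRegularOp f‖ * (‖p ξ a r‖ * ‖p η b r‖) := by
        refine (norm_sum_le _ _).trans (Finset.sum_le_sum fun r _ => ?_)
        calc _ ≤ ‖p η b r‖ * ‖leftRegularOp f (p ξ a r)‖ := norm_inner_le_norm _ _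
          _ ≤ ‖p η b r‖ * (‖leftRegularOp f‖ * ‖p ξ a r‖) := by
            gcongr; exact (leftRegularOp f).le_opNorm _
          _ = _ := by ring
    _ = ‖leftRegularOp f‖ * ∑ r, ‖p ξ a r‖ * ‖p η b r‖ := by rw [Finset.mul_sum]
    _ ≤ ‖leftRegularOp f‖ * ((‖ξ‖ * ‖a‖) * (‖η‖ * ‖b‖)) := by gcongr
    _ = _ := by ring

theorem norm_leftRegularOp_mul_le (f u : G → ℂ) :
    ‖leftRegularOp (f * u)‖ ≤ ‖leftRegularOp f‖ * fourierNorm u := by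
  refine opNorm_le_of_inner _ _ (mul_nonneg (norm_nonneg _) (fourierNorm_nonneg u))
    fun ξ η => ?_
  rw [inner_leftRegularOp]
  have h := norm_pairing_le (fun x => f x * ∑ s, ξ (x⁻¹ * s) * star (η s)) u
  have h2 := norm_leftRegularOp_mul_coefficient f ξ η
  calc _ = ‖∑ x, (f x * ∑ s, ξ (x⁻¹ * s) * star (η s)) * u x‖ := by
        congr 1
        refine Finset.sum_congr rfl fun x _ => ?_
        simp only [Pi.mul_apply]; ring
    _ ≤ _ := h
    _ ≤ ‖leftRegularOp f‖ * (‖ξ‖ * ‖η‖) * fourierNorm u :=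
        mul_le_mul_of_nonneg_right h2 (fourierNorm_nonneg u)
    _ = _ := by ring

variable (G)

/-- The norm of `A(G)` is a norm on the algebra of functions `G → ℂ` with pointwise product. -/
noncomputable def fourierRingNorm : RingNorm (G → ℂ) where
  toFun := fourierNorm
  map_zero' := by simp [fourierNorm]
  add_le' u v := by
    have : Nonempty {f : G → ℂ // ‖leftRegularOp f‖ ≤ 1} := ⟨0, by simp [leftRegularOp_zero]⟩
    refine ciSup_le fun f => ?_
    have hu := le_ciSup (fourierNorm_bddAbove u) f
    have hv := le_ciSup (fourierNorm_bddAbove v) f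
    calc _ = ‖(∑ x, f.1 x * u x) + ∑ x, f.1 x * v x‖ := by
          simp [mul_add, Finset.sum_add_distrib]
      _ ≤ _ := (norm_add_le _ _).trans (add_le_add hu hv)
  neg' u := by simp [fourierNorm]
  mul_le' u v := by
    have : Nonempty {f : G → ℂ // ‖leftRegularOp f‖ ≤ 1} := ⟨0, by simp [leftRegularOp_zero]⟩
    refine ciSup_le fun f => ?_
    calc _ = ‖∑ x, (f.1 * u) x * v x‖ := by simp [mul_assoc]
      _ ≤ ‖leftRegularOp (f.1 * u)‖ * fourierNorm v := norm_pairing_le _ _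
      _ ≤ (‖leftRegularOp f.1‖ * fourierNorm u) * fourierNorm v :=
          mul_le_mul_of_nonneg_right (norm_leftRegularOp_mul_le _ _) (fourierNorm_nonneg v)
      _ ≤ (1 * fourierNorm u) * fourierNorm v :=
          mul_le_mul_of_nonneg_right
            (mul_le_mul_of_nonneg_right f.2 (fourierNorm_nonneg u)) (fourierNorm_nonneg v)
      _ = _ := by rw [one_mul]
  eq_zero_of_map_eq_zero' u hu := by
    classical
    ext x
    have h := norm_pairing_le (Pi.single x 1) u
    have h2 : fourierNorm u = 0 := hu
    rw [h2, mul_zero] at h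
    simpa [Pi.single_apply] using h

/-- The Fourier algebra `A(G)` of a finite group `G`: all functions `G → ℂ` with the pointwise
product and the Fourier norm. -/
def FourierAlgebra : Type u := G → ℂ

noncomputable instance : NormedCommRing (FourierAlgebra G) :=
  { (fourierRingNorm G).toNormedRing with
    mul_comm := fun u v => mul_comm (show G → ℂ from u) (show G → ℂ from v) }

noncomputable instance : Algebra ℂ (FourierAlgebra G) := inferInstanceAs (Algebra ℂ (G → ℂ))

noncomputable instance : NormedAlgebra ℂ (FourierAlgebra G) where
  norm_smul_le c u := by
    have h : ∀ v : G → ℂ, fourierNorm (c • v) ≤ ‖c‖ * fourierNorm v := fun v => by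
      have : Nonempty {f : G → ℂ // ‖leftRegularOp f‖ ≤ 1} := ⟨0, by simp [leftRegularOp_zero]⟩
      refine ciSup_le fun f => ?_
      have h := le_ciSup (fourierNorm_bddAbove v) f
      calc _ = ‖c‖ * ‖∑ x, f.1 x * v x‖ := by
            rw [← norm_mul, Finset.mul_sum]
            simp [mul_left_comm]
        _ ≤ _ := mul_le_mul_of_nonneg_left h (norm_nonneg _)
    exact h u

instance : FiniteDimensional ℂ (FourierAlgebra G) :=
  inferInstanceAs (FiniteDimensional ℂ (G → ℂ))

/-- The central Fourier algebra `ZA(G)`: the class functions in `A(G)`. -/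
def ZA : Subalgebra ℂ (FourierAlgebra G) where
  carrier := {u | ∀ x y : G, (show G → ℂ from u) (x * y * x⁻¹) = (show G → ℂ from u) y}
  mul_mem' hu hv x y := congrArg₂ (· * ·) (hu x y) (hv x y)
  add_mem' hu hv x y := congrArg₂ (· + ·) (hu x y) (hv x y)
  algebraMap_mem' _ _ _ := rfl

end FourierAlgebra

/-! ### Frobenius groups -/

section Frobenius

variable {G : Type u} [Group G]

/-- `H` is a Frobenius complement in `G`: a proper non-trivial subgroup with
`H ∩ gHg⁻¹ = {e}` for all `g ∉ H`. -/
structure IsFrobeniusComplement (H : Subgroup G) : Prop where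
  ne_bot : H ≠ ⊥
  ne_top : H ≠ ⊤
  inf_conj : ∀ g : G, g ∉ H → H ⊓ H.map (MulAut.conj g).toMonoidHom = ⊥

/-- The Frobenius kernel `K = (G \ ⋃ gHg⁻¹) ∪ {e}`. -/
def frobeniusKernel (H : Subgroup G) : Set G :=
  (⋃ g : G, (H.map (MulAut.conj g).toMonoidHom : Set G))ᶜ ∪ {1}

end Frobenius

/-! ### Projective norms, and the amenability constant of a commutative algebra with a diagonal. -/

section ProjectiveNorm

variable {A : Type u} [NonUnitalNormedRing A] [NormedSpace ℂ A]

/-! In a finite-dimensional commutative algebra a diagonal ω is unique and approximate diagonals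
converge to it, so the amenability constant is the projective norm of ω. An upper bound comes from
any expansion of ω, a lower bound from a contractive bilinear form
(`amenabilityConstant_eq_of_diagonal`). Below, N is the kernel, h = |H| and k = |N|; commutativity
makes the kernel a normal subgroup by elementary counting
(`IsFrobeniusComplement.exists_decomposition`).

For ZL¹(G) the diagonal is the sum of e ⊗ e over the minimal central idempotents e, with an explicit
kernel W on G × G (`diagCoeff`), and its projective norm is the ℓ¹-norm of W. The decisive fact is
that W(x⁻¹, y) is non-negative when x and y are conjugate and non-positive otherwise
(`norm_diagKernel`). As W has total sum 1, its ℓ¹-norm is 2S − 1, where S is the sum of W(x⁻¹, y)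
over conjugate pairs.

For ZA(G) the diagonal is the indicator of conjugacy. The function p(x, y) = W(x⁻¹, y) is a
self-adjoint idempotent of the group algebra of G × G, so 2p − δ acts contractively
(`norm_leftRegularOp_kernel_le`); it pairs with the indicator to 2S − 1 again. For the upper bound
the indicator is expanded in products of irreducible characters, whose Fourier norms are at most
their degrees, and the weighted sum of the absolute values of the coefficients is once more the same
number (`sum_irrCoeff_mul_irrDegree`). -/

theorem exists_eq_sum_tmul (z : A ⊗[ℂ] A) :
    ∃ (n : ℕ) (a b : Fin n → A), z = ∑ i, a i ⊗ₜ[ℂ] b i := by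
  induction z with
  | zero => exact ⟨0, 0, 0, by simp⟩
  | tmul x y => exact ⟨1, fun _ => x, fun _ => y, by simp⟩
  | add x y hx hy =>
    obtain ⟨n, a, b, rfl⟩ := hx
    obtain ⟨m, c, d, rfl⟩ := hy
    exact ⟨n + m, Fin.append a c, Fin.append b d, by simp [Fin.sum_univ_add]⟩

theorem projectiveNorm_sum_tmul_le {ι : Type*} [Fintype ι] (a b : ι → A) :
    projectiveNorm (∑ i, a i ⊗ₜ[ℂ] b i) ≤ ∑ i, ‖a i‖ * ‖b i‖ := by
  refine csInf_le ⟨0, ?_⟩ ⟨Fintype.card ι, a ∘ (Fintype.equivFin ι).symm,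
    b ∘ (Fintype.equivFin ι).symm, ?_, ?_⟩
  · rintro r ⟨n, a, b, -, rfl⟩
    positivity
  · exact (Equiv.sum_comp (Fintype.equivFin ι).symm fun i => a i ⊗ₜ[ℂ] b i).symm
  · exact (Equiv.sum_comp (Fintype.equivFin ι).symm fun i => ‖a i‖ * ‖b i‖).symm

/-- Every representation of `z` gives the bound, and the infimum inherits it. This is the source of
all lower bounds on projective norms. -/
theorem norm_lift_le_projectiveNorm (B : A →ₗ[ℂ] A →ₗ[ℂ] ℂ) (C : ℝ) (hC : 0 ≤ C)
    (hB : ∀ a b, ‖B a b‖ ≤ C * (‖a‖ * ‖b‖)) (z : A ⊗[ℂ] A) :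
    ‖TensorProduct.lift B z‖ ≤ C * projectiveNorm z := by
  have key : ∀ r ∈ {r : ℝ | ∃ (n : ℕ) (a b : Fin n → A),
      z = ∑ i, a i ⊗ₜ[ℂ] b i ∧ r = ∑ i, ‖a i‖ * ‖b i‖}, ‖TensorProduct.lift B z‖ ≤ C * r := by
    rintro r ⟨n, a, b, rfl, rfl⟩
    simp only [map_sum, TensorProduct.lift.tmul, Finset.mul_sum]
    exact (norm_sum_le _ _).trans (Finset.sum_le_sum fun i _ => hB _ _)
  obtain ⟨n, a, b, hz⟩ := exists_eq_sum_tmul z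
  have hne : {r : ℝ | ∃ (n : ℕ) (a b : Fin n → A),
      z = ∑ i, a i ⊗ₜ[ℂ] b i ∧ r = ∑ i, ‖a i‖ * ‖b i‖}.Nonempty := ⟨_, n, a, b, hz, rfl⟩
  -- Passing to the infimum divides by `C`, so `C = 0` is treated apart.
  rcases hC.eq_or_lt with rfl | hC
  · simpa using key _ hne.some_mem
  · rw [← div_le_iff₀' hC]
    exact le_csInf hne fun r hr => (div_le_iff₀' hC).2 (key r hr)

variable [IsScalarTower ℂ A A] [SMulCommClass ℂ A A]

omit [IsScalarTower ℂ A A] in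
@[simp] theorem tensorLeftAct_tmul (a b c : A) :
    tensorLeftAct a (b ⊗ₜ[ℂ] c) = (a * b) ⊗ₜ c := by
  simp [tensorLeftAct]

omit [SMulCommClass ℂ A A] in
@[simp] theorem tensorRightAct_tmul (a b c : A) :
    tensorRightAct a (b ⊗ₜ[ℂ] c) = b ⊗ₜ (c * a) := by
  simp [tensorRightAct]

/-- A commutative finite-dimensional algebra with a diagonal `ω` whose projective norm is computed
by a contractive bilinear form has that norm as its amenability constant. -/
theorem amenabilityConstant_eq_of_diagonal [FiniteDimensional ℂ A]
    (hcomm : ∀ a b : A, a * b = b * a) (ω : A ⊗[ℂ] A)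
    (hω : ∀ a, tensorLeftAct a ω = tensorRightAct a ω)
    (hm : ∀ a, a * LinearMap.mul' ℂ A ω = a) (V : ℝ) (hV : projectiveNorm ω ≤ V)
    (B : A →ₗ[ℂ] A →ₗ[ℂ] ℂ) (hB : ∀ a b, ‖B a b‖ ≤ ‖a‖ * ‖b‖)
    (hBω : TensorProduct.lift B ω = V) :
    amenabilityConstant A = ENNReal.ofReal V := by
  apply le_antisymm
  · have h0 : projectiveNorm (0 : A ⊗[ℂ] A) = 0 := by
      apply le_antisymm
      · simpa using projectiveNorm_sum_tmul_le (A := A) (ι := Fin 0) 0 0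
      · simpa using norm_lift_le_projectiveNorm (A := A) 0 1 zero_le_one
          (fun a b => by simpa using by positivity) 0
    have hd : IsBoundedApproxDiagonal fun _ : PUnit.{u + 1} => ω :=
      ⟨⟨projectiveNorm ω, fun _ => le_rfl⟩, fun a => by simp [hω, h0], fun a => by simp [hm]⟩
    calc amenabilityConstant A ≤ ⨆ _ : PUnit.{u + 1}, ENNReal.ofReal (projectiveNorm ω) :=
          sInf_le ⟨PUnit.{u + 1}, inferInstance, inferInstance, inferInstance, _, hd, rfl⟩
      _ ≤ ENNReal.ofReal V := by simpa using ENNReal.ofReal_le_ofReal hV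
  · refine le_sInf ?_
    rintro r ⟨ι, _, _, _, w, hw, rfl⟩
    obtain ⟨n, a, b, hab⟩ := exists_eq_sum_tmul ω
    have hB1 : ∀ a b, ‖B a b‖ ≤ 1 * (‖a‖ * ‖b‖) := fun a b => by simpa using hB a b
    -- This is the product ωz in A ⊗ A: for z = c ⊗ d it equals c·ω·d, which is cd·ω since ω is a
    -- diagonal.
    have hL : ∀ z : A ⊗[ℂ] A, ∑ i, tensorRightAct (b i) (tensorLeftAct (a i) z) =
        tensorLeftAct (LinearMap.mul' ℂ A z) ω := by
      intro z
      induction z with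
      | zero => simp [tensorLeftAct]
      | add x y hx hy =>
        simp only [map_add, Finset.sum_add_distrib, hx, hy]
        rw [tensorLeftAct, tensorLeftAct, tensorLeftAct, ← LinearMap.add_apply,
          ← LinearMap.rTensor_add]
        congr 2
        ext
        simp [add_mul]
      | tmul c d =>
        have h1 : tensorLeftAct (c * d) ω = tensorLeftAct c (tensorRightAct d ω) := by
          rw [← hω, hab]
          simp [mul_assoc]
        rw [LinearMap.mul'_apply, h1, hab]
        simp [hcomm c, hcomm d]
    have hR : ∀ z : A ⊗[ℂ] A, ∑ i, tensorRightAct (b i) (tensorRightAct (a i) z) = z := by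
      intro z
      induction z with
      | zero => simp
      | add x y hx hy => simp only [map_add, Finset.sum_add_distrib, hx, hy]
      | tmul c d =>
        have h1 : LinearMap.mul' ℂ A ω = ∑ i, a i * b i := by rw [hab]; simp
        have h2 := hm d
        rw [h1, Finset.mul_sum] at h2
        simp only [tensorRightAct_tmul, mul_assoc, ← TensorProduct.tmul_sum, h2]
    -- Together `hL` and `hR` give w = m(w)·ω − ∑ (aᵢ·w − w·aᵢ)·bᵢ. Under `B` the first term tends
    -- to `V` and the second to 0.
    have hsplit : ∀ α, TensorProduct.lift B (w α) =
        ∑ i, B (a i * LinearMap.mul' ℂ A (w α)) (b i) -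
        ∑ i, TensorProduct.lift B (tensorRightAct (b i)
          (tensorLeftAct (a i) (w α) - tensorRightAct (a i) (w α))) := by
      intro α
      have h1 := hL (w α)
      have h2 : TensorProduct.lift B (tensorLeftAct (LinearMap.mul' ℂ A (w α)) ω) =
          ∑ i, B (a i * LinearMap.mul' ℂ A (w α)) (b i) := by
        rw [hab]
        simp [hcomm _ (LinearMap.mul' ℂ A (w α))]
      rw [← h2, ← h1]
      simp only [map_sub, Finset.sum_sub_distrib, map_sum]
      rw [sub_sub_cancel, ← map_sum, hR]
    have ht1 : Filter.Tendsto (fun α => ∑ i, B (a i * LinearMap.mul' ℂ A (w α)) (b i))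
        Filter.atTop (𝓝 (∑ i, B (a i) (b i))) := by
      refine tendsto_finsetSum _ fun i _ => ?_
      have hc : Continuous (B.flip (b i)) := LinearMap.continuous_of_finiteDimensional _
      exact (hc.tendsto _).comp (hw.tendsto_mul (a i))
    have ht2 : Filter.Tendsto (fun α => ∑ i, TensorProduct.lift B (tensorRightAct (b i)
          (tensorLeftAct (a i) (w α) - tensorRightAct (a i) (w α)))) Filter.atTop (𝓝 0) := by
      rw [← Finset.sum_const_zero (s := (Finset.univ : Finset (Fin n)))]
      refine tendsto_finsetSum _ fun i _ => ?_
      refine squeeze_zero_norm (a := fun α => ‖b i‖ * projectiveNorm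
        (tensorLeftAct (a i) (w α) - tensorRightAct (a i) (w α))) (fun α => ?_) ?_
      -- The right action of `b i` is absorbed into the form, at the cost of a factor `‖b i‖`.
      · have h := norm_lift_le_projectiveNorm (B.compl₂ (LinearMap.mulRight ℂ (b i))) ‖b i‖
          (norm_nonneg _) (fun x y => ?_)
          (tensorLeftAct (a i) (w α) - tensorRightAct (a i) (w α))
        · refine (le_of_eq ?_).trans h
          congr 1
          rw [tensorRightAct, ← LinearMap.comp_apply]
          congr 1
          ext x y
          simp
        · rw [LinearMap.compl₂_apply, LinearMap.mulRight_apply]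
          calc _ ≤ ‖x‖ * ‖y * b i‖ := hB _ _
            _ ≤ ‖x‖ * (‖y‖ * ‖b i‖) := by gcongr; exact norm_mul_le _ _
            _ = _ := by ring
      · simpa using (hw.tendsto_comm (a i)).const_mul ‖b i‖
    have ht : Filter.Tendsto (fun α => TensorProduct.lift B (w α)) Filter.atTop (𝓝 (V : ℂ)) := by
      have h := ht1.sub ht2
      simp only [← hsplit] at h
      rwa [sub_zero, show ∑ i, B (a i) (b i) = (V : ℂ) by rw [← hBω, hab]; simp] at h
    have ht3 : Filter.Tendsto (fun α => ENNReal.ofReal ‖TensorProduct.lift B (w α)‖) Filter.atTop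
        (𝓝 (ENNReal.ofReal ‖(V : ℂ)‖)) := (ENNReal.continuous_ofReal.tendsto _).comp ht.norm
    refine (ENNReal.ofReal_le_ofReal (le_abs_self V)).trans ?_
    rw [Complex.norm_real, Real.norm_eq_abs] at ht3
    refine le_of_tendsto ht3 (Filter.Eventually.of_forall fun α => ?_)
    refine le_trans (ENNReal.ofReal_le_ofReal ?_)
      (le_iSup (fun α => ENNReal.ofReal (projectiveNorm (w α))) α)
    simpa using norm_lift_le_projectiveNorm B 1 zero_le_one hB1 (w α)

end ProjectiveNorm

/-! ### Class functions and tensors of class functions as kernels on G × G. -/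

section ClassFunctions

/-- The space of class functions on a group. -/
def classFunctions (G : Type u) [Group G] : Submodule ℂ (G → ℂ) where
  carrier := {u | ∀ x y : G, u (x * y * x⁻¹) = u y}
  add_mem' hu hv x y := congrArg₂ (· + ·) (hu x y) (hv x y)
  zero_mem' _ _ := rfl
  smul_mem' c _ hu x y := congrArg (c * ·) (hu x y)

variable {G : Type u} [Group G]

theorem classFunctions_apply_eq (u : classFunctions G) {x y : G} (h : IsConj x y) :
    u.1 x = u.1 y := by
  obtain ⟨c, rfl⟩ := isConj_iff.1 h
  exact (u.2 c x).symm

theorem classFunctions_mul_comm (u : classFunctions G) (x y : G) :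
    u.1 (x * y) = u.1 (y * x) := by
  simpa [mul_assoc] using u.2 x (y * x)

/-- A chosen element of a conjugacy class. -/
noncomputable def classRep (c : ConjClasses G) : G := Function.surjInv ConjClasses.mk_surjective c

@[simp] theorem mk_classRep (c : ConjClasses G) : ConjClasses.mk (classRep c) = c :=
  Function.surjInv_eq _ c

theorem isConj_classRep (x : G) : IsConj x (classRep (ConjClasses.mk x)) :=
  ConjClasses.mk_eq_mk_iff_isConj.1 (mk_classRep _).symm

open Classical in
/-- The indicator function of a conjugacy class. -/
noncomputable def classIndicator (c : ConjClasses G) : classFunctions G :=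
  ⟨fun y => if ConjClasses.mk y = c then 1 else 0, fun x y => by
    simp only [ConjClasses.mk_eq_mk_iff_isConj.2 (isConj_iff.2 ⟨x⁻¹, by group⟩ : IsConj (x * y * x⁻¹) y)]⟩

variable [Fintype G]

open Classical in
theorem classFunctions_eq_sum (u : classFunctions G) :
    u = ∑ c, u.1 (classRep c) • classIndicator c := by
  ext x
  simp only [classIndicator, AddSubmonoidClass.coe_finsetSum, Submodule.coe_smul,
    Finset.sum_apply, Pi.smul_apply, smul_eq_mul, mul_ite, mul_one, mul_zero]
  rw [Finset.sum_ite_eq, if_pos (Finset.mem_univ _)]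
  exact classFunctions_apply_eq u (isConj_classRep x)

variable {A : Type u} [AddCommGroup A] [Module ℂ A] (e : A ≃ₗ[ℂ] classFunctions G)

omit [Fintype G] in
/-- Evaluation at `(x, y)` of a tensor of class functions. -/
noncomputable def tensorEval (x y : G) : A ⊗[ℂ] A →ₗ[ℂ] ℂ :=
  LinearMap.mul' ℂ ℂ ∘ₗ TensorProduct.map
    (LinearMap.proj x ∘ₗ (classFunctions G).subtype ∘ₗ e.toLinearMap)
    (LinearMap.proj y ∘ₗ (classFunctions G).subtype ∘ₗ e.toLinearMap)

omit [Fintype G] in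
@[simp] theorem tensorEval_tmul (x y : G) (a b : A) :
    tensorEval e x y (a ⊗ₜ b) = (e a).1 x * (e b).1 y := by
  simp [tensorEval]

open Classical in
theorem eq_sum_tensorEval (z : A ⊗[ℂ] A) :
    z = ∑ p : ConjClasses G × ConjClasses G, tensorEval e (classRep p.1) (classRep p.2) z •
      (e.symm (classIndicator p.1) ⊗ₜ[ℂ] e.symm (classIndicator p.2)) := by
  induction z with
  | zero => simp
  | add x y hx hy =>
    simp only [map_add, add_smul, Finset.sum_add_distrib]
    rw [← hx, ← hy]
  | tmul a b =>
    have h : ∀ a : A, a = ∑ c, (e a).1 (classRep c) • e.symm (classIndicator c) := fun a => by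
      apply e.injective
      simpa using classFunctions_eq_sum (e a)
    conv_lhs => rw [h a, h b]
    rw [TensorProduct.sum_tmul, Fintype.sum_prod_type]
    refine Finset.sum_congr rfl fun c _ => ?_
    rw [TensorProduct.tmul_sum]
    refine Finset.sum_congr rfl fun d _ => ?_
    rw [tensorEval_tmul, TensorProduct.smul_tmul_smul]

/-- Class indicators form a basis, so a tensor is determined by its values on G × G; diagonal
identities can then be checked pointwise. -/
theorem tensorEval_ext {z w : A ⊗[ℂ] A} (h : ∀ x y, tensorEval e x y z = tensorEval e x y w) :
    z = w := by
  rw [eq_sum_tensorEval e z, eq_sum_tensorEval e w]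
  simp only [h]

/-- A kernel on `G × G` that is a class function in each variable. -/
structure IsClassKernel (W : G → G → ℂ) : Prop where
  left : ∀ g x y, W (g * x * g⁻¹) y = W x y
  right : ∀ g x y, W x (g * y * g⁻¹) = W x y

omit [Fintype G] in
theorem IsClassKernel.congr {W : G → G → ℂ} (hW : IsClassKernel W) {x x' y y' : G}
    (hx : IsConj x x') (hy : IsConj y y') : W x y = W x' y' := by
  obtain ⟨c, rfl⟩ := isConj_iff.1 hx
  obtain ⟨d, rfl⟩ := isConj_iff.1 hy
  rw [hW.left, hW.right]

open Classical in
/-- The tensor of class functions with a given kernel. -/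
noncomputable def tensorOfKernel (W : G → G → ℂ) : A ⊗[ℂ] A :=
  ∑ p : ConjClasses G × ConjClasses G, W (classRep p.1) (classRep p.2) •
      (e.symm (classIndicator p.1) ⊗ₜ[ℂ] e.symm (classIndicator p.2))

theorem tensorEval_tensorOfKernel {W : G → G → ℂ} (hW : IsClassKernel W) (x y : G) :
    tensorEval e x y (tensorOfKernel e W) = W x y := by
  classical
  simp only [tensorOfKernel, map_sum, map_smul, tensorEval_tmul, LinearEquiv.apply_symm_apply,
    classIndicator, Fintype.sum_prod_type, smul_eq_mul, mul_ite, mul_one, mul_zero, Finset.sum_ite_eq, Finset.mem_univ, if_true]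
  exact (hW.congr (isConj_classRep x) (isConj_classRep y)).symm

/-- The bilinear form `(u, v) ↦ ∑ F(x, y) u(x) v(y)` on class functions. -/
noncomputable def kernelForm (F : G → G → ℂ) : A →ₗ[ℂ] A →ₗ[ℂ] ℂ :=
  ∑ x, ∑ y, F x y • TensorProduct.curry (tensorEval e x y)

theorem kernelForm_apply (F : G → G → ℂ) (a b : A) :
    kernelForm e F a b = ∑ x, ∑ y, F x y * ((e a).1 x * (e b).1 y) := by
  simp [kernelForm, LinearMap.sum_apply]

theorem lift_kernelForm (F : G → G → ℂ) (z : A ⊗[ℂ] A) :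
    TensorProduct.lift (kernelForm e F) z = ∑ x, ∑ y, F x y * tensorEval e x y z := by
  induction z with
  | zero => simp
  | add x y hx hy => simp only [map_add, hx, hy, mul_add, Finset.sum_add_distrib]
  | tmul a b => simp [kernelForm_apply]

end ClassFunctions

/-! ### The centre of L¹(G) and the ℓ¹ formula for its amenability constant. -/

section CentreOfGroupAlgebra

variable (G : Type u) [Group G] [Fintype G]

variable {G} in
/-- The coefficients of an element of `L¹(G)`. -/
noncomputable def L1.coeffs (f : L1 G) : G → ℂ :=
  fun x => (show MonoidAlgebra ℂ G from f).coeff x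

variable {G} in
theorem L1.norm_eq (f : L1 G) : ‖f‖ = ∑ x, ‖f.coeffs x‖ := rfl

variable {G} in
theorem L1.coeffs_mul (f g : L1 G) (x : G) :
    (f * g).coeffs x = ∑ y, f.coeffs y * g.coeffs (y⁻¹ * x) := by
  have h : ∀ f g : MonoidAlgebra ℂ G, (f * g).coeff x = ∑ y, f.coeff y * g.coeff (y⁻¹ * x) :=
    fun f g => by rw [MonoidAlgebra.coeff_mul_apply_left, Finsupp.sum_fintype _ _ (by simp)]
  exact h f g

omit [Group G] [Fintype G] in
variable {G} in
theorem L1.coeffs_injective : Function.Injective (L1.coeffs : L1 G → G → ℂ) := fun _ _ h =>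
  MonoidAlgebra.coeff_injective (DFunLike.coe_injective h)

/-- The centre of the group algebra is the space of class functions. -/
noncomputable def centreEquiv : ZL1 G ≃ₗ[ℂ] classFunctions G where
  toFun f := ⟨f.1.coeffs, fun x y => by
    have h : ∀ p : MonoidAlgebra ℂ G, MonoidAlgebra.single x 1 * p = p * MonoidAlgebra.single x 1 →
        p.coeff (x * y * x⁻¹) = p.coeff y := fun p h => by
      have h2 := congrArg (fun p : MonoidAlgebra ℂ G => p.coeff (x * y)) h
      simpa using h2.symm
    exact h _ (Subalgebra.mem_center_iff.1 f.2 (MonoidAlgebra.single x 1 : MonoidAlgebra ℂ G))⟩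
  map_add' f g := rfl
  map_smul' c f := rfl
  invFun u := ⟨(show L1 G from (MonoidAlgebra.coeffLinearEquiv (S := ℂ) (M := G) ℂ).symm
    (Finsupp.equivFunOnFinite.symm u.1)), Subalgebra.mem_center_iff.2 fun f =>
      L1.coeffs_injective <| funext fun x => by
        rw [L1.coeffs_mul, L1.coeffs_mul]
        change ∑ y, f.coeffs y * u.1 (y⁻¹ * x) = ∑ y, u.1 y * f.coeffs (y⁻¹ * x)
        rw [← Equiv.sum_comp ((Equiv.inv G).trans (Equiv.mulLeft x)) fun y => u.1 y * _]
        refine Finset.sum_congr rfl fun y _ => ?_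
        simp [classFunctions_mul_comm u x, mul_comm]⟩
  left_inv f := by
    apply Subtype.ext
    apply L1.coeffs_injective
    rfl
  right_inv u := rfl

variable {G}

theorem ZL1.mul_comm (f g : ZL1 G) : f * g = g * f :=
  Subtype.ext (Subalgebra.mem_center_iff.1 g.2 f.1)

theorem ZL1.norm_eq (f : ZL1 G) : ‖f‖ = ∑ x, ‖(centreEquiv G f).1 x‖ := rfl

theorem centreEquiv_mul (f g : ZL1 G) (x : G) : (centreEquiv G (f * g)).1 x =
    ∑ y, (centreEquiv G f).1 y * (centreEquiv G g).1 (y⁻¹ * x) :=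
  L1.coeffs_mul f.1 g.1 x

open Classical in
theorem norm_symm_classIndicator (c : ConjClasses G) :
    ‖(centreEquiv G).symm (classIndicator c)‖ = ∑ x, if ConjClasses.mk x = c then 1 else 0 := by
  rw [ZL1.norm_eq]
  refine Finset.sum_congr rfl fun x _ => ?_
  rw [LinearEquiv.apply_symm_apply]
  simp only [classIndicator]
  split_ifs <;> simp

open Classical in
theorem sum_mul_sum_ite_mk (f : ConjClasses G → ℝ) :
    ∑ c, f c * ∑ x, (if ConjClasses.mk x = c then 1 else 0) = ∑ x, f (ConjClasses.mk x) := by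
  simp only [Finset.mul_sum, mul_ite, mul_one, mul_zero]
  rw [Finset.sum_comm]
  simp

/-- The projective norm on `ZL¹(G) ⊗ ZL¹(G)` is at most the `ℓ¹`-norm on `G × G`. -/
theorem projectiveNorm_tensorOfKernel_le {W : G → G → ℂ} (hW : IsClassKernel W) :
    projectiveNorm (tensorOfKernel (centreEquiv G) W) ≤ ∑ x, ∑ y, ‖W x y‖ := by
  classical
  -- Products of class indicators have disjoint supports, so this expansion costs exactly the
  -- ℓ¹-norm of `W`.
  simp only [tensorOfKernel, TensorProduct.smul_tmul']
  refine (projectiveNorm_sum_tmul_le _ _).trans (le_of_eq ?_)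
  simp only [norm_smul, norm_symm_classIndicator, Fintype.sum_prod_type, sum_mul_sum_ite_mk]
  rw [Finset.sum_comm]
  simp only [sum_mul_sum_ite_mk fun c => ‖W (classRep c) _‖]
  rw [Finset.sum_comm]
  exact Finset.sum_congr rfl fun x _ => Finset.sum_congr rfl fun y _ =>
    congrArg _ (hW.congr (isConj_classRep x) (isConj_classRep y)).symm

/-- The amenability constant of `ZL¹(G)` is the `ℓ¹`-norm of the kernel of its diagonal. -/
theorem amenabilityConstant_ZL1 [DecidableEq G] {W : G → G → ℂ} (hW : IsClassKernel W)
    (hcomm : ∀ (a : classFunctions G) (x y : G),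
      ∑ g, a.1 g * W (g⁻¹ * x) y = ∑ g, a.1 g * W x (g⁻¹ * y))
    (hone : ∀ x, ∑ g, W g (g⁻¹ * x) = if x = 1 then 1 else 0) :
    amenabilityConstant (ZL1 G) = ENNReal.ofReal (∑ x, ∑ y, ‖W x y‖) := by
  have hev := tensorEval_tensorOfKernel (centreEquiv G) hW
  refine amenabilityConstant_eq_of_diagonal ZL1.mul_comm (tensorOfKernel (centreEquiv G) W)
    (fun a => ?_) (fun a => ?_) _ (projectiveNorm_tensorOfKernel_le hW)
    -- The norming form uses the conjugate phase of `W`; where `W` vanishes the quotient is 0, which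
    -- is harmless.
    (kernelForm (centreEquiv G) fun x y => starRingEnd ℂ (W x y) / ‖W x y‖) (fun a b => ?_) ?_
  · refine tensorEval_ext (centreEquiv G) fun x y => ?_
    have h1 : ∀ z : ZL1 G ⊗[ℂ] ZL1 G, tensorEval (centreEquiv G) x y (tensorLeftAct a z) =
        ∑ g, (centreEquiv G a).1 g * tensorEval (centreEquiv G) (g⁻¹ * x) y z := fun z => by
      induction z with
      | zero => simp
      | add z w hz hw => simp only [map_add, hz, hw, mul_add, Finset.sum_add_distrib]
      | tmul b c => simp [centreEquiv_mul, Finset.sum_mul, mul_assoc]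
    have h2 : ∀ z : ZL1 G ⊗[ℂ] ZL1 G, tensorEval (centreEquiv G) x y (tensorRightAct a z) =
        ∑ g, (centreEquiv G a).1 g * tensorEval (centreEquiv G) x (g⁻¹ * y) z := fun z => by
      induction z with
      | zero => simp
      | add z w hz hw => simp only [map_add, hz, hw, mul_add, Finset.sum_add_distrib]
      | tmul b c =>
        simp [ZL1.mul_comm c a, centreEquiv_mul, Finset.mul_sum, mul_left_comm]
    rw [h1, h2]
    simp only [hev, hcomm]
  · have h1 : ∀ (z : ZL1 G ⊗[ℂ] ZL1 G) (x : G),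
        (centreEquiv G (LinearMap.mul' ℂ _ z)).1 x =
          ∑ g, tensorEval (centreEquiv G) g (g⁻¹ * x) z := fun z x => by
      induction z with
      | zero => simp
      | add z w hz hw => simp [map_add, hz, hw, Finset.sum_add_distrib]
      | tmul b c => simp [centreEquiv_mul]
    apply (centreEquiv G).injective
    ext x
    rw [centreEquiv_mul]
    simp only [h1, hev, hone]
    simp [inv_mul_eq_one]
  · rw [kernelForm_apply, ZL1.norm_eq, ZL1.norm_eq, Finset.sum_mul_sum]
    refine norm_sum_le_of_le _ fun x _ => norm_sum_le_of_le _ fun y _ => ?_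
    rw [norm_mul, norm_mul]
    refine mul_le_of_le_one_left (by positivity) ?_
    simpa using div_self_le_one _
  · rw [lift_kernelForm]
    push_cast
    refine Finset.sum_congr rfl fun x _ => Finset.sum_congr rfl fun y _ => ?_
    rw [hev, div_mul_eq_mul_div, mul_comm, Complex.mul_conj, Complex.normSq_eq_norm_sq]
    push_cast
    rw [sq, mul_self_div_self]

end CentreOfGroupAlgebra

/-! ### Estimates in A(G), and contractions on ℓ²(G × G). -/

section FourierNorm

variable {G : Type u} [Group G] [Fintype G]

/-- The matrix coefficients of the slice are those of λ(F) at elementary tensors; `p ξ a` is ξ ⊗ a.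
-/
theorem norm_leftRegularOp_slice_le {G' : Type u} [Group G'] [Fintype G'] (F : G × G' → ℂ)
    (ξ η : EuclideanSpace ℂ G) :
    ‖leftRegularOp fun y => ∑ x, F (x, y) * ∑ s, ξ (x⁻¹ * s) * star (η s)‖ ≤
      ‖leftRegularOp F‖ * (‖ξ‖ * ‖η‖) := by
  refine opNorm_le_of_inner _ _ (by positivity) fun a b => ?_
  let p : EuclideanSpace ℂ G → EuclideanSpace ℂ G' → EuclideanSpace ℂ (G × G') :=
    fun ξ a => WithLp.toLp 2 fun q => ξ q.1 * a q.2
  have hp : ∀ ξ a, ‖p ξ a‖ = ‖ξ‖ * ‖a‖ := fun ξ a => by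
    rw [← sq_eq_sq₀ (norm_nonneg _) (by positivity), mul_pow, EuclideanSpace.norm_sq_eq,
      EuclideanSpace.norm_sq_eq, EuclideanSpace.norm_sq_eq, Finset.sum_mul_sum,
      Fintype.sum_prod_type]
    simp [p, mul_pow]
  have hkey : inner ℂ b
      (leftRegularOp (fun y => ∑ x, F (x, y) * ∑ s, ξ (x⁻¹ * s) * star (η s)) a) =
      inner ℂ (p η b) (leftRegularOp F (p ξ a)) := by
    rw [inner_leftRegularOp, inner_leftRegularOp, Fintype.sum_prod_type, Finset.sum_comm]
    refine Finset.sum_congr rfl fun y _ => ?_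
    rw [Finset.sum_mul]
    refine Finset.sum_congr rfl fun x _ => ?_
    rw [mul_assoc, Finset.sum_mul_sum, Fintype.sum_prod_type]
    congr 1
    refine Finset.sum_congr rfl fun s _ => Finset.sum_congr rfl fun t _ => ?_
    simp only [p, Prod.fst_mul, Prod.snd_mul, Prod.fst_inv, Prod.snd_inv, star_mul']
    ring
  rw [hkey]
  calc _ ≤ ‖p η b‖ * ‖leftRegularOp F (p ξ a)‖ := norm_inner_le_norm _ _
    _ ≤ ‖p η b‖ * (‖leftRegularOp F‖ * ‖p ξ a‖) := by
      gcongr; exact (leftRegularOp F).le_opNorm _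
    _ = _ := by rw [hp, hp]; ring

/-- Functions `F` on `G × G'` act on `A(G) × A(G')` as bilinear forms of norm at most `‖λ(F)‖`. -/
theorem norm_sum_sum_le_fourierNorm {G' : Type u} [Group G'] [Fintype G'] (F : G × G' → ℂ)
    (u : G → ℂ) (v : G' → ℂ) :
    ‖∑ x, ∑ y, F (x, y) * (u x * v y)‖ ≤ ‖leftRegularOp F‖ * (fourierNorm u * fourierNorm v) := by
  -- A matrix coefficient of this operator is the pairing of `v` with a slice of `F`, so duality for
  -- `v` reduces to the slice estimate.
  have h1 : ‖leftRegularOp fun x => ∑ y, F (x, y) * v y‖ ≤ ‖leftRegularOp F‖ * fourierNorm v := by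
    refine opNorm_le_of_inner _ _ (mul_nonneg (norm_nonneg _) (fourierNorm_nonneg v))
      fun ξ η => ?_
    have h2 : inner ℂ η (leftRegularOp (fun x => ∑ y, F (x, y) * v y) ξ) =
        ∑ y, (∑ x, F (x, y) * ∑ s, ξ (x⁻¹ * s) * star (η s)) * v y := by
      rw [inner_leftRegularOp]
      simp only [Finset.sum_mul]
      rw [Finset.sum_comm]
      exact Finset.sum_congr rfl fun y _ => Finset.sum_congr rfl fun x _ => by ring
    rw [h2]
    calc _ ≤ _ := norm_pairing_le _ _
      _ ≤ (‖leftRegularOp F‖ * (‖ξ‖ * ‖η‖)) * fourierNorm v :=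
        mul_le_mul_of_nonneg_right (norm_leftRegularOp_slice_le F ξ η) (fourierNorm_nonneg v)
      _ = _ := by ring
  calc _ = ‖∑ x, (∑ y, F (x, y) * v y) * u x‖ := by
        congr 1
        refine Finset.sum_congr rfl fun x _ => ?_
        rw [Finset.sum_mul]
        exact Finset.sum_congr rfl fun y _ => by ring
    _ ≤ _ := norm_pairing_le _ _
    _ ≤ (‖leftRegularOp F‖ * fourierNorm v) * fourierNorm u :=
      mul_le_mul_of_nonneg_right h1 (fourierNorm_nonneg u)
    _ = _ := by ring

/-- A unitary character of a subgroup, extended by zero, has Fourier norm at most one. -/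
theorem fourierNorm_le_one_of_character (D : Subgroup G) (u : G → ℂ) (h0 : ∀ x, x ∉ D → u x = 0)
    (h1 : ∀ x ∈ D, ‖u x‖ = 1) (hmul : ∀ x ∈ D, ∀ y ∈ D, u (x * y) = u x * u y) :
    fourierNorm u ≤ 1 := by
  have : Nonempty {f : G → ℂ // ‖leftRegularOp f‖ ≤ 1} := ⟨0, by simp [leftRegularOp_zero]⟩
  have hsq : ∀ x ∈ D, star (u x) * u x = 1 := fun x hx => by
    simpa [h1 x hx] using RCLike.conj_mul (u x)
  -- With d = |D|, the vector ξ = ū satisfies ⟨λ(x)ξ, ξ⟩ = d·u(x) and ‖ξ‖² = d, so u is a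
  -- coefficient function of a unit vector.
  set ξ : EuclideanSpace ℂ G := WithLp.toLp 2 fun s => star (u s) with hξ
  set d : ℝ := ∑ s, ‖u s‖ ^ 2 with hd
  have hd0 : 0 < d := by
    refine Finset.sum_pos' (fun _ _ => by positivity) ⟨1, Finset.mem_univ _, ?_⟩
    simp [h1 1 D.one_mem]
  have hnorm : ‖ξ‖ ^ 2 = d := by simp [hξ, hd, EuclideanSpace.norm_sq_eq]
  have hcoef : ∀ x, ∑ s, ξ (x⁻¹ * s) * star (ξ s) = d * u x := fun x => by
    rw [hd, Complex.ofReal_sum, Finset.sum_mul]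
    refine Finset.sum_congr rfl fun s _ => ?_
    simp only [hξ, star_star]
    by_cases hs : s ∈ D
    · by_cases hx : x ∈ D
      · have hxs := hmul x hx (x⁻¹ * s) (D.mul_mem (D.inv_mem hx) hs)
        rw [mul_inv_cancel_left] at hxs
        have hxs' := hsq _ (D.mul_mem (D.inv_mem hx) hs)
        rw [h1 s hs, hxs, mul_left_comm, hxs']
        simp
      · rw [h0 x hx, h0 (x⁻¹ * s)]
        · simp
        · rwa [D.mul_mem_cancel_right hs, D.inv_mem_iff]
    · simp [h0 s hs]
  refine ciSup_le fun f => ?_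
  have h2 : (d : ℂ) * ∑ x, f.1 x * u x = inner ℂ ξ (leftRegularOp f.1 ξ) := by
    rw [inner_leftRegularOp, Finset.mul_sum]
    refine Finset.sum_congr rfl fun x _ => ?_
    rw [hcoef]
    ring
  have h3 : ‖(d : ℂ) * ∑ x, f.1 x * u x‖ ≤ d := by
    rw [h2, ← hnorm]
    calc _ ≤ ‖ξ‖ * ‖leftRegularOp f.1 ξ‖ := norm_inner_le_norm _ _
      _ ≤ ‖ξ‖ * (1 * ‖ξ‖) := by
        gcongr
        exact ((leftRegularOp f.1).le_opNorm _).trans (by gcongr; exact f.2)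
      _ = _ := by ring
  rw [norm_mul, Complex.norm_real, Real.norm_of_nonneg hd0.le] at h3
  exact le_of_mul_le_mul_left (by simpa using h3) hd0

theorem leftRegularOp_sub (f g : G → ℂ) :
    leftRegularOp (f - g) = leftRegularOp f - leftRegularOp g := by
  ext ξ s
  simp [leftRegularOp_apply, sub_mul]

theorem leftRegularOp_one [DecidableEq G] :
    leftRegularOp (fun x : G => if x = 1 then (1 : ℂ) else 0) = 1 := by
  ext ξ s
  simp [leftRegularOp_apply]

theorem leftRegularOp_mul (f g : G → ℂ) :
    leftRegularOp f * leftRegularOp g = leftRegularOp fun x => ∑ y, f y * g (y⁻¹ * x) := by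
  ext ξ s
  change leftRegularOp f (leftRegularOp g ξ) s = _
  simp only [leftRegularOp_apply, Finset.sum_mul,
    Finset.mul_sum]
  rw [Finset.sum_comm (s := Finset.univ (α := G)) (f := fun x y => f y * g (y⁻¹ * x) * _)]
  refine Finset.sum_congr rfl fun t _ => ?_
  rw [← Equiv.sum_comp (Equiv.mulLeft t) fun x => f t * g (t⁻¹ * x) * _]
  exact Finset.sum_congr rfl fun r _ => by simp [mul_assoc]

theorem isSelfAdjoint_leftRegularOp {f : G → ℂ} (hf : ∀ x, star (f x⁻¹) = f x) :
    IsSelfAdjoint (leftRegularOp f) := by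
  rw [ContinuousLinearMap.isSelfAdjoint_iff_isSymmetric]
  intro ξ η
  change inner ℂ (leftRegularOp f ξ) η = inner ℂ ξ (leftRegularOp f η)
  rw [← inner_conj_symm, inner_leftRegularOp, inner_leftRegularOp, map_sum,
    ← Equiv.sum_comp (Equiv.inv G)]
  refine Finset.sum_congr rfl fun x _ => ?_
  rw [map_mul]
  congr 1
  · exact hf x
  · rw [map_sum, ← Equiv.sum_comp (Equiv.mulLeft x⁻¹)]
    exact Finset.sum_congr rfl fun s _ => by simp [mul_comm]

/-- Twice a self-adjoint idempotent minus the identity is a contraction. -/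
theorem norm_leftRegularOp_reflection_le [DecidableEq G] {p : G → ℂ}
    (hp : ∀ x, star (p x⁻¹) = p x) (hpp : ∀ x, ∑ y, p y * p (y⁻¹ * x) = p x) :
    ‖leftRegularOp fun x => 2 * p x - if x = 1 then (1 : ℂ) else 0‖ ≤ 1 := by
  have h1 : (leftRegularOp fun x => 2 * p x - if x = 1 then (1 : ℂ) else 0) =
      (2 : ℂ) • leftRegularOp p - 1 := by
    rw [← leftRegularOp_one, ← leftRegularOp_smul, ← leftRegularOp_sub]
    rfl
  have h2 : leftRegularOp p * leftRegularOp p = leftRegularOp p := by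
    rw [leftRegularOp_mul]
    simp only [hpp]
  have hU : IsSelfAdjoint (leftRegularOp fun x => 2 * p x - if x = 1 then (1 : ℂ) else 0) :=
    isSelfAdjoint_leftRegularOp fun x => by
      rw [star_sub, star_mul', hp]
      split_ifs <;> simp_all
  rw [h1] at hU ⊢
  set T := leftRegularOp p
  -- U = 2T − 1 is self-adjoint with U² = 1, and the C*-identity bounds its norm.
  have h4 : star ((2 : ℂ) • T - 1) * ((2 : ℂ) • T - 1) = 1 := by
    rw [hU.star_eq]
    simp only [sub_mul, mul_sub, smul_mul_smul_comm, h2, one_mul, mul_one]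
    module
  have h5 := CStarRing.norm_star_mul_self (x := (2 : ℂ) • T - 1)
  rw [h4] at h5
  have h6 : ‖(1 : EuclideanSpace ℂ G →L[ℂ] EuclideanSpace ℂ G)‖ ≤ 1 :=
    ContinuousLinearMap.norm_id_le
  nlinarith [norm_nonneg ((2 : ℂ) • T - 1)]

/-- The kernel of the diagonal of `ZL¹(G)` gives a contractive bilinear form on `A(G)`. -/
theorem norm_leftRegularOp_kernel_le [DecidableEq G] {W : G → G → ℂ} (hW : IsClassKernel W)
    (hcomm : ∀ (a : classFunctions G) (x y : G),
      ∑ g, a.1 g * W (g⁻¹ * x) y = ∑ g, a.1 g * W x (g⁻¹ * y))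
    (hone : ∀ x, ∑ g, W g (g⁻¹ * x) = if x = 1 then 1 else 0)
    (hstar : ∀ x y, star (W x⁻¹ y⁻¹) = W x y) :
    ‖leftRegularOp fun p : G × G => 2 * W p.1⁻¹ p.2 - if p = 1 then (1 : ℂ) else 0‖ ≤ 1 := by
  -- A diagonal of a commutative algebra is an idempotent of the tensor square. Inverting the first
  -- variable preserves this, because x ↦ x⁻¹ induces an automorphism of the commutative centre.
  refine norm_leftRegularOp_reflection_le (p := fun p : G × G => W p.1⁻¹ p.2)
    (fun p => by simp [← hstar p.1⁻¹ p.2]) fun ⟨x, y⟩ => ?_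
  have hl : ∀ a b z, W (a * b) z = W (b * a) z := fun a b z =>
    classFunctions_mul_comm ⟨fun g => W g z, fun c d => hW.left c d z⟩ a b
  have hr : ∀ a b z, W z (a * b) = W z (b * a) := fun a b z =>
    classFunctions_mul_comm ⟨fun g => W z g, fun c d => hW.right c z d⟩ a b
  simp only [Fintype.sum_prod_type, Prod.inv_mk, Prod.mk_mul_mk]
  calc ∑ a, ∑ b, W a⁻¹ b * W (a⁻¹ * x)⁻¹ (b⁻¹ * y)
      = ∑ a, ∑ b, W a b * W (a⁻¹ * x⁻¹) (b⁻¹ * y) := by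
        rw [← Equiv.sum_comp (Equiv.inv G)]
        refine Finset.sum_congr rfl fun a _ => Finset.sum_congr rfl fun b _ => ?_
        simp [hl x⁻¹]
    -- For fixed `b` the function `W · b` is a class function, so `hcomm` moves its action to the
    -- second variable; afterwards a sum of the form in `hone` splits off.
    _ = ∑ b, ∑ a, W a b * W x⁻¹ (a⁻¹ * (b⁻¹ * y)) := by
        rw [Finset.sum_comm]
        exact Finset.sum_congr rfl fun b _ =>
          hcomm ⟨fun g => W g b, fun c d => hW.left c d b⟩ x⁻¹ (b⁻¹ * y)
    _ = ∑ a, ∑ c, W a (a⁻¹ * c) * W x⁻¹ (c⁻¹ * y) := by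
        rw [Finset.sum_comm]
        refine Finset.sum_congr rfl fun a _ => ?_
        rw [← Equiv.sum_comp (Equiv.mulRight a⁻¹)]
        refine Finset.sum_congr rfl fun c _ => ?_
        simp only [Equiv.coe_mulRight, mul_inv_rev, inv_inv, hr c]
        simp [mul_assoc]
    _ = W x⁻¹ y := by
        rw [Finset.sum_comm]
        simp [← Finset.sum_mul, hone]

end FourierNorm

/-! ### The diagonal of ZA(G). -/

section CentralFourierAlgebra

variable (G : Type u) [Group G] [Fintype G]

/-- The elements of `ZA(G)` are the class functions. -/
noncomputable def centralFourierEquiv : ZA G ≃ₗ[ℂ] classFunctions G where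
  toFun f := ⟨f.1, f.2⟩
  map_add' _ _ := rfl
  map_smul' _ _ := rfl
  invFun u := ⟨u.1, u.2⟩
  left_inv _ := rfl
  right_inv _ := rfl

variable {G}

theorem ZA.norm_eq (f : ZA G) : ‖f‖ = fourierNorm (centralFourierEquiv G f).1 := rfl

theorem centralFourierEquiv_mul (f g : ZA G) (x : G) : (centralFourierEquiv G (f * g)).1 x =
    (centralFourierEquiv G f).1 x * (centralFourierEquiv G g).1 x := rfl

open Classical in
/-- The amenability constant of `ZA(G)`, from a representation of its diagonal and a function
on `G × G` acting contractively. -/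
theorem amenabilityConstant_ZA {V : ℝ} (F : G → G → ℂ)
    (hF : ‖leftRegularOp fun p : G × G => F p.1 p.2‖ ≤ 1)
    (hFV : ∑ x, ∑ y, F x y * (if IsConj x y then 1 else 0) = V)
    (ω : ZA G ⊗[ℂ] ZA G)
    (hω : ∀ x y, tensorEval (centralFourierEquiv G) x y ω = if IsConj x y then 1 else 0)
    (hV : projectiveNorm ω ≤ V) :
    amenabilityConstant (ZA G) = ENNReal.ofReal V := by
  refine amenabilityConstant_eq_of_diagonal mul_comm ω (fun a => ?_) (fun a => ?_) _ hV
    (kernelForm (centralFourierEquiv G) F) (fun a b => ?_) ?_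
  · refine tensorEval_ext (centralFourierEquiv G) fun x y => ?_
    have h1 : ∀ z : ZA G ⊗[ℂ] ZA G, tensorEval (centralFourierEquiv G) x y (tensorLeftAct a z) =
        (centralFourierEquiv G a).1 x * tensorEval (centralFourierEquiv G) x y z := fun z => by
      induction z with
      | zero => simp
      | add z w hz hw => simp only [map_add, hz, hw, mul_add]
      | tmul b c => simp [centralFourierEquiv_mul, mul_assoc]
    have h2 : ∀ z : ZA G ⊗[ℂ] ZA G, tensorEval (centralFourierEquiv G) x y (tensorRightAct a z) =
        (centralFourierEquiv G a).1 y * tensorEval (centralFourierEquiv G) x y z := fun z => by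
      induction z with
      | zero => simp
      | add z w hz hw => simp only [map_add, hz, hw, mul_add]
      | tmul b c => simp [centralFourierEquiv_mul]; ring
    rw [h1, h2, hω]
    split_ifs with h
    · rw [classFunctions_apply_eq _ h]
    · simp
  · have h1 : ∀ (z : ZA G ⊗[ℂ] ZA G) (x : G),
        (centralFourierEquiv G (LinearMap.mul' ℂ _ z)).1 x =
          tensorEval (centralFourierEquiv G) x x z := fun z x => by
      induction z with
      | zero => simp
      | add z w hz hw => simp [map_add, hz, hw]
      | tmul b c => simp [centralFourierEquiv_mul]
    apply (centralFourierEquiv G).injective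
    ext x
    rw [centralFourierEquiv_mul, h1, hω, if_pos (IsConj.refl x), mul_one]
  · rw [kernelForm_apply, ZA.norm_eq, ZA.norm_eq]
    refine (norm_sum_sum_le_fourierNorm (fun p : G × G => F p.1 p.2) _ _).trans ?_
    exact mul_le_of_le_one_left (mul_nonneg (fourierNorm_nonneg _) (fourierNorm_nonneg _)) hF
  · rw [lift_kernelForm, ← hFV]
    simp only [hω]

end CentralFourierAlgebra

/-! ### The kernel as a normal complement of H. -/

section FrobeniusDecomposition

variable {G : Type u} [Group G]

/-- `G = N ⋊ H` with `N` and `H` abelian, `N` non-trivial, and `H` acting freely on `N \ {1}`. -/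
structure IsFrobeniusDecomposition (N H : Subgroup G) : Prop where
  ne_bot : N ≠ ⊥
  comm_left : ∀ a ∈ N, ∀ b ∈ N, a * b = b * a
  comm_right : ∀ a ∈ H, ∀ b ∈ H, a * b = b * a
  exists_mul : ∀ g : G, ∃ n ∈ N, ∃ t ∈ H, g = n * t
  disjoint : ∀ x ∈ N, x ∈ H → x = 1
  eq_one : ∀ t ∈ H, ∀ x ∈ N, t * x * t⁻¹ = x → t ≠ 1 → x = 1

theorem IsFrobeniusComplement.mem_of_conj_mem {H : Subgroup G} (hG : IsFrobeniusComplement H)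
    {g x : G} (hx : x ∈ H) (hx1 : x ≠ 1) (hg : g * x * g⁻¹ ∈ H) : g ∈ H := by
  by_contra h
  have h1 : g * x * g⁻¹ ∈ H ⊓ H.map (MulAut.conj g).toMonoidHom :=
    ⟨hg, x, hx, rfl⟩
  rw [hG.inf_conj g h, Subgroup.mem_bot, conj_eq_one_iff] at h1
  exact hx1 h1

theorem mem_frobeniusKernel_iff {H : Subgroup G} {x : G} :
    x ∈ frobeniusKernel H ↔ (∀ g, ∀ y ∈ H, g * y * g⁻¹ ≠ x) ∨ x = 1 := by
  simp [frobeniusKernel, or_comm]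

variable [Finite G]

/-- A conjugate gHg⁻¹ depends only on the coset gH, so the complement of the kernel has at most [G :
H](|H| − 1) elements, leaving at least [G : H]. Disjointness of the conjugates is not needed for
this inequality. -/
theorem index_le_ncard_frobeniusKernel (H : Subgroup G) :
    H.index ≤ (frobeniusKernel H).ncard := by
  classical
  have := Fintype.ofFinite G
  have hsub : (frobeniusKernel H)ᶜ ⊆ Set.range fun p : (G ⧸ H) × {x : H // x ≠ 1} =>
      p.1.out * (p.2.1 : G) * p.1.out⁻¹ := by
    intro s hs
    rw [Set.mem_compl_iff, mem_frobeniusKernel_iff] at hs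
    push Not at hs
    obtain ⟨⟨g, x, hx, rfl⟩, hs1⟩ := hs
    obtain ⟨u, hu⟩ := QuotientGroup.mk_out_eq_mul H g
    have hx1 : x ≠ 1 := by rintro rfl; simp at hs1
    refine ⟨⟨(g : G ⧸ H), ⟨u⁻¹ * ⟨x, hx⟩ * u, ?_⟩⟩, ?_⟩
    · intro h
      apply hx1
      have h2 : (⟨x, hx⟩ : H) = 1 := by
        have h3 := congrArg (fun z => u * z * u⁻¹) h
        simpa [mul_assoc] using h3
      exact congrArg Subtype.val h2
    · simp only [hu, Subgroup.coe_mul, Subgroup.coe_inv]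
      group
  have h1 := Set.ncard_le_ncard hsub (Set.toFinite _)
  have h2 : (Set.range fun p : (G ⧸ H) × {x : H // x ≠ 1} =>
      p.1.out * (p.2.1 : G) * p.1.out⁻¹).ncard ≤ H.index * (Nat.card H - 1) := by
    rw [← Set.image_univ]
    refine (Set.ncard_image_le (Set.toFinite _)).trans (le_of_eq ?_)
    rw [Set.ncard_univ, Nat.card_prod, Subgroup.index]
    congr 1
    rw [Nat.card_eq_fintype_card, Nat.card_eq_fintype_card, Fintype.card_subtype_compl]
    simp
  have h3 := Set.ncard_add_ncard_compl (frobeniusKernel H)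
  have h4 := H.card_mul_index
  -- Writing |H| = m + 1 removes the truncated subtraction.
  obtain ⟨m, hm⟩ : ∃ m, Nat.card H = m + 1 := Nat.exists_eq_succ_of_ne_zero Nat.card_pos.ne'
  rw [hm] at h2 h4
  rw [Nat.add_sub_cancel] at h2
  nlinarith

/-- A Frobenius group with abelian complement whose kernel consists of commuting elements is the
semidirect product of its kernel and its complement. -/
theorem IsFrobeniusComplement.exists_decomposition {H : Subgroup G}
    (hG : IsFrobeniusComplement H)
    (hK : ∀ a ∈ frobeniusKernel H, ∀ b ∈ frobeniusKernel H, a * b = b * a)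
    (hH : ∀ a ∈ H, ∀ b ∈ H, a * b = b * a) :
    ∃ N : Subgroup G, (N : Set G) = frobeniusKernel H ∧ N.Normal ∧
      IsFrobeniusDecomposition N H := by
  -- The centraliser of a non-trivial element of H lies in H.
  have hcomm : ∀ x ∈ H, x ≠ 1 → ∀ y, x * y = y * x → y ∈ H := fun x hx hx1 y hxy =>
    hG.mem_of_conj_mem hx hx1 (by rwa [← hxy, mul_inv_cancel_right])
  have hindex := index_le_ncard_frobeniusKernel H
  have hone : 1 < H.index := Subgroup.one_lt_index_of_ne_top hG.ne_top
  obtain ⟨y, hyK, hy1⟩ := Set.exists_ne_of_one_lt_ncard (hone.trans_le hindex) 1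
  have hyH : y ∉ H := fun hyH => by
    rcases mem_frobeniusKernel_iff.1 hyK with h | h
    · exact h 1 y hyH (by simp)
    · exact hy1 h
  let N := Subgroup.closure (frobeniusKernel H)
  have hKN : frobeniusKernel H ⊆ N := Subgroup.subset_closure
  have hNc : ∀ a ∈ N, ∀ b ∈ N, a * b = b * a := by
    have h1 : N ≤ Subgroup.centralizer (frobeniusKernel H) := by
      rw [Subgroup.closure_le]
      exact fun a ha b hb => hK b hb a ha
    have h2 : N ≤ Subgroup.centralizer (N : Set G) := by
      rw [Subgroup.closure_le]
      exact fun a ha b hb => (h1 hb a ha).symm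
    exact fun a ha b hb => h2 hb a ha
  -- A non-trivial element of N ∩ H would commute with `y`, forcing `y` into H.
  have hdis : ∀ x ∈ N, x ∈ H → x = 1 := fun x hxN hxH => by
    by_contra hx1
    exact hyH (hcomm x hxH hx1 y (hNc x hxN y (hKN hyK)))
  have hinj : Function.Injective fun p : N × H => (p.1 : G) * p.2 :=
    Subgroup.mul_injective_of_disjoint (Subgroup.disjoint_def.2 fun {x} => hdis x)
  have hcard : Nat.card N * Nat.card H ≤ Nat.card G := by
    rw [← Nat.card_prod]
    exact Nat.card_le_card_of_injective _ hinj
  have hpos : 0 < Nat.card H := Nat.card_pos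
  have hG' := H.card_mul_index
  have hle : (frobeniusKernel H).ncard ≤ Nat.card N := Set.ncard_le_ncard hKN
  -- This closes the chain |N| ≤ [G : H] ≤ |K| ≤ |N|, so the closure adds nothing to the kernel K.
  have hNi : Nat.card N ≤ H.index := by nlinarith
  have hNK : (N : Set G) = frobeniusKernel H :=
    (Set.eq_of_subset_of_ncard_le hKN (hNi.trans hindex)).symm
  have hsurj : Function.Surjective fun p : N × H => (p.1 : G) * p.2 := by
    refine ((Nat.bijective_iff_injective_and_card _).2 ⟨hinj, ?_⟩).2
    rw [Nat.card_prod]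
    nlinarith
  refine ⟨N, hNK, ⟨fun n hn g => ?_⟩, ?_, hNc, hH, fun g => ?_, hdis, fun t ht x hx htx ht1 => ?_⟩
  · rw [← SetLike.mem_coe, hNK, mem_frobeniusKernel_iff] at hn ⊢
    refine hn.imp (fun h c z hz hcz => h (g⁻¹ * c) z hz ?_) fun h => by simp [h]
    calc _ = g⁻¹ * (c * z * c⁻¹) * g := by group
      _ = n := by rw [hcz]; group
  · intro h
    exact hy1 (by simpa [h] using hKN hyK)
  · obtain ⟨⟨n, t⟩, rfl⟩ := hsurj g
    exact ⟨n, n.2, t, t.2, rfl⟩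
  · exact hdis x hx (hcomm t ht ht1 x (mul_inv_eq_iff_eq_mul.1 htx))

end FrobeniusDecomposition

/-! ### Conjugacy classes of N ⋊ H. -/

section Structure

variable {G : Type u} [Group G] {N H : Subgroup G} [hN : N.Normal]

namespace IsFrobeniusDecomposition

theorem mk_mul_comm (hF : IsFrobeniusDecomposition N H) (x y : G) :
    (x : G ⧸ N) * y = y * x := by
  obtain ⟨n, hn, t, ht, rfl⟩ := hF.exists_mul x
  obtain ⟨m, hm, s, hs, rfl⟩ := hF.exists_mul y
  have h : ∀ n ∈ N, (n : G ⧸ N) = 1 := fun n hn => (QuotientGroup.eq_one_iff n).2 hn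
  rw [QuotientGroup.mk_mul, QuotientGroup.mk_mul, h n hn, h m hm, one_mul, one_mul,
    ← QuotientGroup.mk_mul, hF.comm_right t ht s hs, QuotientGroup.mk_mul]

-- The N-part of `s` centralises the abelian group N, so freeness of the action of H extends to
-- every element outside N.
omit hN in
theorem eq_one_of_commute (hF : IsFrobeniusDecomposition N H) {s x : G} (hs : s ∉ N) (hx : x ∈ N)
    (h : s * x * s⁻¹ = x) : x = 1 := by
  obtain ⟨n, hn, t, ht, rfl⟩ := hF.exists_mul s
  refine hF.eq_one t ht x hx ?_ ?_
  · calc t * x * t⁻¹ = n⁻¹ * (n * t * x * (n * t)⁻¹) * n := by group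
      _ = x := by rw [h, hF.comm_left _ (N.inv_mem hn) x hx]; group
  · rintro rfl
    exact hs (by simpa using hn)

variable [Finite G]

/-- The map n ↦ sns⁻¹n⁻¹ from N to itself is injective, since `s` fixes no non-trivial element of N;
finiteness makes it bijective. -/
theorem existsUnique_commutator (hF : IsFrobeniusDecomposition N H) {s y : G} (hs : s ∉ N)
    (hy : y ∈ N) : ∃! n : G, n ∈ N ∧ s * n * s⁻¹ * n⁻¹ = y := by
  let f : N → N := fun n => ⟨s * n * s⁻¹ * (n : G)⁻¹,
    N.mul_mem (hN.conj_mem n n.2 s) (N.inv_mem n.2)⟩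
  have hf : Function.Injective f := by
    intro a b hab
    have h1 : s * a * s⁻¹ * (a : G)⁻¹ = s * b * s⁻¹ * (b : G)⁻¹ := congrArg Subtype.val hab
    have h2 := hF.eq_one_of_commute hs (N.mul_mem (N.inv_mem b.2) a.2) ?_
    · exact Subtype.ext (inv_mul_eq_one.1 h2).symm
    · calc s * ((b : G)⁻¹ * a) * s⁻¹ = (s * b * s⁻¹)⁻¹ * (s * a * s⁻¹ * (a : G)⁻¹) * a := by group
        _ = (b : G)⁻¹ * a := by rw [h1]; group
  obtain ⟨n, hn⟩ := (Finite.surjective_of_injective hf) ⟨y, hy⟩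
  refine ⟨n, ⟨n.2, congrArg Subtype.val hn⟩, fun m ⟨hm, hmy⟩ => ?_⟩
  exact congrArg Subtype.val (hf (a₁ := ⟨m, hm⟩) (a₂ := n) ((Subtype.ext hmy).trans hn.symm))

/-- Commutators of `x` with N fill N, so conjugation by N already sweeps out the whole coset xN. -/
theorem isConj_of_mem (hF : IsFrobeniusDecomposition N H) {x y : G} (hx : x ∉ N)
    (hxy : x⁻¹ * y ∈ N) : IsConj x y := by
  obtain ⟨n, ⟨hn, h⟩, -⟩ := hF.existsUnique_commutator hx
    (hN.conj_mem _ (N.inv_mem hxy) x)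
  refine isConj_iff.2 ⟨n, ?_⟩
  calc n * x * n⁻¹ = (x * n * x⁻¹ * n⁻¹)⁻¹ * x := by group
    _ = y := by rw [h]; group

theorem isConj_iff_of_notMem (hF : IsFrobeniusDecomposition N H) {x y : G} (hx : x ∉ N) :
    IsConj x y ↔ x⁻¹ * y ∈ N := by
  refine ⟨fun h => ?_, hF.isConj_of_mem hx⟩
  obtain ⟨c, rfl⟩ := isConj_iff.1 h
  rw [← QuotientGroup.eq_one_iff, QuotientGroup.mk_mul, QuotientGroup.mk_mul,
    QuotientGroup.mk_mul, hF.mk_mul_comm c x]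
  simp

omit [Finite G] in
theorem isConj_iff_of_mem (hF : IsFrobeniusDecomposition N H) {x y : G} (hx : x ∈ N) :
    IsConj x y ↔ ∃ t ∈ H, t * x * t⁻¹ = y := by
  refine ⟨fun h => ?_, fun ⟨t, _, h⟩ => isConj_iff.2 ⟨t, h⟩⟩
  obtain ⟨c, rfl⟩ := isConj_iff.1 h
  obtain ⟨n, hn, t, ht, rfl⟩ := hF.exists_mul c
  refine ⟨t, ht, ?_⟩
  calc t * x * t⁻¹ = n * (t * x * t⁻¹) * n⁻¹ := by
        rw [hF.comm_left n hn _ (hN.conj_mem x hx t)]; group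
    _ = n * t * x * (n * t)⁻¹ := by group

omit hN [Finite G] in
theorem card_eq (hF : IsFrobeniusDecomposition N H) :
    Nat.card G = Nat.card H * Nat.card N := by
  have h : Function.Bijective fun p : H × N => (p.2 : G) * p.1 := by
    refine ⟨fun p q hpq => ?_, fun g => ?_⟩
    · have h := Subgroup.mul_injective_of_disjoint
        (Subgroup.disjoint_def.2 fun {x} => hF.disjoint x) (a₁ := p.swap) (a₂ := q.swap) hpq
      exact Prod.swap_injective h
    · obtain ⟨n, hn, t, ht, rfl⟩ := hF.exists_mul g
      exact ⟨⟨⟨t, ht⟩, ⟨n, hn⟩⟩, rfl⟩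
  rw [← Nat.card_prod]
  exact (Nat.card_congr (Equiv.ofBijective _ h)).symm

omit hN [Finite G] in
theorem conj_injective (hF : IsFrobeniusDecomposition N H) {x : G} (hx : x ∈ N) (hx1 : x ≠ 1)
    {s t : G} (hs : s ∈ H) (ht : t ∈ H) (h : s * x * s⁻¹ = t * x * t⁻¹) : s = t := by
  by_contra hst
  refine hx1 (hF.eq_one (t⁻¹ * s) (H.mul_mem (H.inv_mem ht) hs) x hx ?_ ?_)
  · calc t⁻¹ * s * x * (t⁻¹ * s)⁻¹ = t⁻¹ * (s * x * s⁻¹) * t := by group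
      _ = x := by rw [h]; group
  · rwa [ne_eq, inv_mul_eq_one, eq_comm]

/-- The H-orbit of a non-trivial element of N is free and misses 1. This inequality fixes the signs
later on. -/
theorem card_lt_card (hF : IsFrobeniusDecomposition N H) : Nat.card H < Nat.card N := by
  obtain ⟨x, hx, hx1⟩ := N.bot_or_exists_ne_one.resolve_left hF.ne_bot
  let f : H → N := fun t => ⟨t * x * (t : G)⁻¹, hN.conj_mem x hx t⟩
  have hf : Function.Injective f := fun s t hst =>
    Subtype.ext (hF.conj_injective hx hx1 s.2 t.2 (congrArg Subtype.val hst))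
  have h1 : (1 : N) ∉ Set.range f := by
    rintro ⟨t, ht⟩
    exact hx1 (conj_eq_one_iff.1 (congrArg Subtype.val ht))
  have h2 := Set.ncard_lt_card (s := Set.range f) fun h => h1 (h ▸ Set.mem_univ _)
  rwa [← Set.image_univ, Set.ncard_image_of_injective _ hf, Set.ncard_univ] at h2

end IsFrobeniusDecomposition

end Structure

/-! ### The kernel of the diagonal of ZL¹(G), and the diagonal identities. -/

section DiagonalKernel

open scoped Classical

variable {G : Type u} [Group G]

/-- The indicator function of a subgroup. -/
noncomputable def memInd (N : Subgroup G) (x : G) : ℂ := if x ∈ N then 1 else 0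

theorem memInd_of_mem {N : Subgroup G} {x : G} (h : x ∈ N) : memInd N x = 1 := if_pos h

theorem memInd_of_notMem {N : Subgroup G} {x : G} (h : x ∉ N) : memInd N x = 0 := if_neg h

theorem memInd_congr {N : Subgroup G} {x y : G} (h : x ∈ N ↔ y ∈ N) :
    memInd N x = memInd N y := by
  simp [memInd, h]

theorem memInd_inv (N : Subgroup G) (x : G) : memInd N x⁻¹ = memInd N x :=
  memInd_congr N.inv_mem_iff

theorem memInd_conj (N : Subgroup G) [hN : N.Normal] (g x : G) :
    memInd N (g * x * g⁻¹) = memInd N x :=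
  memInd_congr ⟨fun h => by simpa [mul_assoc] using hN.conj_mem _ h g⁻¹,
    fun h => hN.conj_mem _ h g⟩

variable [Fintype G]

theorem sum_memInd (N : Subgroup G) : ∑ x, memInd N x = Nat.card N := by
  simp [memInd, Finset.sum_boole, Nat.card_eq_fintype_card, Fintype.card_subtype]

/-- The number of `t ∈ H` that conjugate `x` to `y⁻¹`. -/
noncomputable def conjCount (H : Subgroup G) (x y : G) : ℂ :=
  ∑ t : H, if (t : G) * x * (t : G)⁻¹ * y = 1 then 1 else 0

theorem conjCount_comm (H : Subgroup G) (x y : G) : conjCount H x y = conjCount H y x := by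
  rw [conjCount, conjCount, ← Equiv.sum_comp (Equiv.inv H)]
  refine Finset.sum_congr rfl fun t _ => ?_
  have h : (t : G)⁻¹ * x * t * y = 1 ↔ t * y * (t : G)⁻¹ * x = 1 := by
    constructor
    · intro h
      calc t * y * (t : G)⁻¹ * x = t * ((y * ((t : G)⁻¹ * x * t * y) * y⁻¹)) * (t : G)⁻¹ := by
            group
        _ = 1 := by rw [h]; group
    · intro h
      calc (t : G)⁻¹ * x * t * y = (t : G)⁻¹ * (x * (t * y * (t : G)⁻¹ * x) * x⁻¹) * t := by
            group
        _ = 1 := by rw [h]; group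
  simp [h]

/-- The kernel of the diagonal of `ZL¹(N ⋊ H)`, up to the factor `|G|²`. -/
noncomputable def diagKernel (N H : Subgroup G) (x y : G) : ℂ :=
  Nat.card H * memInd N (x * y) + memInd N x * memInd N y *
    (Nat.card H ^ 2 * Nat.card N * conjCount H x y - Nat.card H ^ 3)

variable {N H : Subgroup G} [hN : N.Normal]

omit [Fintype G] in
theorem memInd_mul_comm (N : Subgroup G) [hN : N.Normal] (x y : G) :
    memInd N (x * y) = memInd N (y * x) :=
  memInd_congr hN.mem_comm_iff

theorem diagKernel_comm (N H : Subgroup G) [N.Normal] (x y : G) :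
    diagKernel N H x y = diagKernel N H y x := by
  rw [diagKernel, diagKernel, conjCount_comm, memInd_mul_comm N x y]
  ring

theorem sum_memInd_mul_conjCount (H : Subgroup G) {y : G} (hy : y ∈ N) :
    ∑ x, memInd N x * conjCount H x y = Nat.card H := by
  simp only [conjCount, Finset.mul_sum]
  rw [Finset.sum_comm, Finset.sum_congr rfl fun t _ => ?_, Finset.sum_const, Finset.card_univ,
    nsmul_one, Nat.card_eq_fintype_card]
  rw [Finset.sum_eq_single ((t : G)⁻¹ * y⁻¹ * t)]
  · rw [memInd_of_mem, if_pos] <;> simp [mul_assoc]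
    simpa [mul_assoc] using hN.conj_mem _ (N.inv_mem hy) (t : G)⁻¹
  · intro x _ hx
    rw [if_neg, mul_zero]
    intro h
    apply hx
    calc x = (t : G)⁻¹ * (t * x * (t : G)⁻¹ * y) * y⁻¹ * t := by group
      _ = _ := by rw [h]; group
  · simp

namespace IsFrobeniusDecomposition

theorem conjCount_conj (hF : IsFrobeniusDecomposition N H) (g : G) {x : G} (hx : x ∈ N) (y : G) :
    conjCount H (g * x * g⁻¹) y = conjCount H x y := by
  obtain ⟨s, hs, h⟩ := (hF.isConj_iff_of_mem hx).1 (isConj_iff.2 ⟨g, rfl⟩)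
  rw [← h, conjCount, conjCount, ← Equiv.sum_comp (Equiv.mulRight (⟨s, hs⟩ : H)⁻¹)]
  refine Finset.sum_congr rfl fun t _ => ?_
  simp [mul_assoc]

theorem diagKernel_conj (hF : IsFrobeniusDecomposition N H) (g x y : G) :
    diagKernel N H (g * x * g⁻¹) y = diagKernel N H x y := by
  have h1 : memInd N (g * x * g⁻¹ * y) = memInd N (x * y) := memInd_congr <| by
    rw [← QuotientGroup.eq_one_iff, ← QuotientGroup.eq_one_iff]
    simp [hF.mk_mul_comm g x]
  rw [diagKernel, diagKernel, h1, memInd_conj]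
  by_cases hx : x ∈ N
  · rw [hF.conjCount_conj g hx]
  · simp [memInd_of_notMem hx]

/-- The right side becomes symmetric in `x` and `y` because `a` is a class function, which is what
the commutation identity of the diagonal needs. -/
theorem sum_mul_abelianKernel (hF : IsFrobeniusDecomposition N H) (a : classFunctions G)
    (x y : G) :
    ∑ g, a.1 g * (memInd N (g⁻¹ * x) * memInd N y *
        (Nat.card H ^ 2 * Nat.card N * conjCount H (g⁻¹ * x) y - Nat.card H ^ 3)) =
      memInd N x * memInd N y * (Nat.card H ^ 2 * Nat.card N *
        ∑ t : H, a.1 (x * ((t : G)⁻¹ * y * t)) - Nat.card H ^ 3 * ∑ g, memInd N g * a.1 g) := by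
  by_cases hy : y ∈ N
  swap
  · simp [memInd_of_notMem hy]
  by_cases hx : x ∈ N
  · have h1 : ∀ g, memInd N (g⁻¹ * x) = memInd N g := fun g => memInd_congr <| by
      rw [N.mul_mem_cancel_right hx, N.inv_mem_iff]
    have h2 : ∑ g, memInd N g * a.1 g * conjCount H (g⁻¹ * x) y =
        ∑ t : H, a.1 (x * ((t : G)⁻¹ * y * t)) := by
      simp only [conjCount, Finset.mul_sum]
      rw [Finset.sum_comm]
      refine Finset.sum_congr rfl fun t _ => ?_
      have hg : ∀ g : G, t * (g⁻¹ * x) * (t : G)⁻¹ * y = 1 ↔ g = x * ((t : G)⁻¹ * y * t) := by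
        intro g
        constructor
        · intro h
          calc g = g * ((t : G)⁻¹ * (t * (g⁻¹ * x) * (t : G)⁻¹ * y) * t) := by rw [h]; group
            _ = _ := by group
        · rintro rfl
          group
      simp only [hg, mul_ite, mul_one, mul_zero, Finset.sum_ite_eq', Finset.mem_univ, if_true]
      rw [memInd_of_mem, one_mul]
      exact N.mul_mem hx (by simpa using hN.conj_mem _ hy (t : G)⁻¹)
    rw [← h2]
    simp only [h1, memInd_of_mem hx, memInd_of_mem hy, Finset.mul_sum]
    rw [one_mul, one_mul, ← Finset.sum_sub_distrib]
    exact Finset.sum_congr rfl fun g _ => by ring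
  -- Off N the function `a` is constant on the coset xN and comes out of the sum; the remaining sum
  -- over N is h²k·h − h³·k = 0.
  · have h1 : ∀ g, a.1 g * memInd N (g⁻¹ * x) = a.1 x * memInd N (g⁻¹ * x) := fun g => by
      by_cases hg : g⁻¹ * x ∈ N
      · rw [classFunctions_apply_eq a (hF.isConj_of_mem hx (y := g)
          (by simpa using N.inv_mem hg))]
      · simp [memInd_of_notMem hg]
    simp only [← mul_assoc, h1, memInd_of_notMem hx, zero_mul]
    rw [← Equiv.sum_comp ((Equiv.inv G).trans (Equiv.mulLeft x))]
    simp only [Equiv.trans_apply, Equiv.inv_apply, Equiv.coe_mulLeft, mul_inv_rev, inv_inv,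
      inv_mul_cancel_right, memInd_of_mem hy]
    have h2 := sum_memInd_mul_conjCount H hy
    have h3 := sum_memInd N
    calc _ = a.1 x * (Nat.card H ^ 2 * Nat.card N * ∑ g, memInd N g * conjCount H g y -
          Nat.card H ^ 3 * ∑ g, memInd N g) := by
          simp only [Finset.mul_sum, ← Finset.sum_sub_distrib]
          exact Finset.sum_congr rfl fun g _ => by ring
      _ = 0 := by rw [h2, h3]; ring

theorem sum_mul_diagKernel (hF : IsFrobeniusDecomposition N H) (a : classFunctions G) (x y : G) :
    ∑ g, a.1 g * diagKernel N H (g⁻¹ * x) y = ∑ g, a.1 g * diagKernel N H x (g⁻¹ * y) := by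
  have h1 : ∀ g, memInd N (g⁻¹ * x * y) = memInd N (g⁻¹ * y * x) := fun g => memInd_congr <| by
    rw [← QuotientGroup.eq_one_iff, ← QuotientGroup.eq_one_iff]
    simp [mul_assoc, hF.mk_mul_comm x y]
  have h2 : ∑ t : H, a.1 (y * ((t : G)⁻¹ * x * t)) = ∑ t : H, a.1 (x * ((t : G)⁻¹ * y * t)) := by
    rw [← Equiv.sum_comp (Equiv.inv H)]
    refine Finset.sum_congr rfl fun t _ => ?_
    rw [classFunctions_mul_comm, ← a.2 (t : G)⁻¹]
    simp [mul_assoc]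
  simp only [diagKernel_comm N H x]
  simp only [diagKernel, mul_add, Finset.sum_add_distrib, hF.sum_mul_abelianKernel, h1, h2]
  ring

/-- For x in N the count of pairs (g, t) is h − 1, one for each t ≠ 1, plus k if x = 1. The terms
h·hk + h²k(h − 1) − h³k cancel and only h²k² at x = 1 survives. -/
theorem sum_diagKernel (hF : IsFrobeniusDecomposition N H) (x : G) :
    ∑ g, diagKernel N H g (g⁻¹ * x) =
      if x = 1 then ((Nat.card H : ℂ) * Nat.card N) ^ 2 else 0 := by
  have hG : (Fintype.card G : ℂ) = Nat.card H * Nat.card N := by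
    rw [← Nat.card_eq_fintype_card, hF.card_eq]
    push_cast
    rfl
  by_cases hx : x ∈ N
  swap
  · rw [if_neg (by rintro rfl; exact hx N.one_mem)]
    refine Finset.sum_eq_zero fun g _ => ?_
    by_cases hg : g ∈ N
    · simp [diagKernel, memInd_of_notMem hx,
        memInd_of_notMem (mt (N.mul_mem_cancel_left (N.inv_mem hg)).1 hx)]
    · simp [diagKernel, memInd_of_notMem hx, memInd_of_notMem hg]
  have h1 : ∀ g, memInd N g * memInd N (g⁻¹ * x) = memInd N g := fun g => by
    rw [memInd_congr (N.mul_mem_cancel_right hx : g⁻¹ * x ∈ N ↔ _), memInd_inv]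
    by_cases hg : g ∈ N <;> simp [memInd, hg]
  have h2 : ∀ t : H, ∑ g, memInd N g *
      (if (t : G) * g * (t : G)⁻¹ * (g⁻¹ * x) = 1 then 1 else 0) =
      if t = 1 then (if x = 1 then (Nat.card N : ℂ) else 0) else 1 := by
    intro t
    split_ifs with ht hx1
    · subst ht hx1
      simp [sum_memInd]
    · subst ht
      simp [hx1]
    · have htN : (t : G) ∉ N := fun h => ht (Subtype.ext (hF.disjoint t h t.2))
      obtain ⟨n, ⟨hn, hn2⟩, hu⟩ := hF.existsUnique_commutator htN (N.inv_mem hx)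
      rw [Finset.sum_eq_single n, memInd_of_mem hn, if_pos, one_mul]
      · rw [← mul_assoc, hn2, inv_mul_cancel]
      · intro g _ hg
        by_cases hgN : g ∈ N
        · rw [if_neg, mul_zero]
          intro h
          rw [← mul_assoc] at h
          exact hg (hu g ⟨hgN, eq_inv_of_mul_eq_one_left h⟩)
        · simp [memInd_of_notMem hgN]
      · simp
  have h3 : ∑ g, memInd N g * conjCount H g (g⁻¹ * x) =
      (Nat.card H - 1) + if x = 1 then (Nat.card N : ℂ) else 0 := by
    simp only [conjCount, Finset.mul_sum]
    rw [Finset.sum_comm]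
    simp only [h2]
    rw [← Finset.add_sum_erase _ _ (Finset.mem_univ 1), if_pos rfl,
      Finset.sum_congr rfl fun t ht => if_neg (Finset.ne_of_mem_erase ht), Finset.sum_const,
      Finset.card_erase_of_mem (Finset.mem_univ _), Finset.card_univ, nsmul_one,
      Nat.cast_pred Fintype.card_pos, Nat.card_eq_fintype_card (α := H), add_comm]
  simp only [diagKernel, mul_inv_cancel_left, h1, memInd_of_mem hx, Finset.sum_add_distrib,
    Finset.sum_const, Finset.card_univ, nsmul_eq_mul, hG]
  calc _ = (Nat.card H : ℂ) * Nat.card N * (Nat.card H * 1) + (Nat.card H ^ 2 * Nat.card N *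
        ∑ g, memInd N g * conjCount H g (g⁻¹ * x) - Nat.card H ^ 3 * ∑ g, memInd N g) := by
        simp only [Finset.mul_sum, ← Finset.sum_sub_distrib]
        congr 1
        exact Finset.sum_congr rfl fun g _ => by ring
    _ = _ := by
        rw [h3, sum_memInd]
        split_ifs <;> ring

/-- The indicator of conjugacy. -/
theorem ite_isConj (hF : IsFrobeniusDecomposition N H) (x y : G) :
    (if IsConj x y then 1 else 0 : ℂ) = memInd N (x⁻¹ * y) + memInd N x * memInd N y *
      (conjCount H x⁻¹ y - 1 - (Nat.card H - 1) * ((if x = 1 then 1 else 0) *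
        if y = 1 then 1 else 0)) := by
  -- On N the −1 cancels the coset indicator. The count is then 1 on conjugate pairs and 0 on
  -- others, except at x = y = 1, where all h elements count; hence the correction by h − 1.
  by_cases hx : x ∈ N
  swap
  · rw [memInd_of_notMem hx, zero_mul, zero_mul, add_zero]
    simp only [hF.isConj_iff_of_notMem hx, memInd]
  have h1 : memInd N (x⁻¹ * y) = memInd N y :=
    memInd_congr (N.mul_mem_cancel_left (N.inv_mem hx))
  rw [h1]
  by_cases hy : y ∈ N
  swap
  · rw [if_neg, memInd_of_notMem hy]
    · ring
    · rw [hF.isConj_iff_of_mem hx]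
      rintro ⟨t, -, rfl⟩
      exact hy (hN.conj_mem x hx t)
  rw [memInd_of_mem hx, memInd_of_mem hy]
  have h2 : ∀ t : H, t * x⁻¹ * (t : G)⁻¹ * y = 1 ↔ t * x * (t : G)⁻¹ = y := fun t => by
    rw [show t * x⁻¹ * (t : G)⁻¹ = (t * x * (t : G)⁻¹)⁻¹ by group, inv_mul_eq_one]
  simp only [conjCount, h2, hF.isConj_iff_of_mem hx]
  by_cases hx1 : x = 1
  · subst hx1
    by_cases hy1 : y = 1
    · subst hy1
      rw [if_pos ⟨1, H.one_mem, by simp⟩]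
      simp [Nat.card_eq_fintype_card]
    · simp [hy1, Ne.symm hy1]
  · rw [if_neg hx1]
    by_cases h : ∃ t ∈ H, t * x * t⁻¹ = y
    · rw [if_pos h]
      obtain ⟨t, ht, rfl⟩ := h
      rw [Finset.sum_eq_single ⟨t, ht⟩]
      · simp
      · intro s _ hs
        rw [if_neg]
        exact fun h => hs (Subtype.ext (hF.conj_injective hx hx1 s.2 ht h))
      · simp
    · rw [if_neg h, Finset.sum_eq_zero]
      · simp
      · intro t _
        rw [if_neg]
        exact fun h' => h ⟨t, t.2, h'⟩

end IsFrobeniusDecomposition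

end DiagonalKernel

/-! ### Signs and sums of the kernel. -/

section DiagonalKernel

open scoped Classical

variable {G : Type u} [Group G] [Fintype G]

omit [Fintype G] in
theorem star_memInd (N : Subgroup G) (x : G) : star (memInd N x) = memInd N x := by
  by_cases hx : x ∈ N <;> simp [memInd, hx]

theorem star_conjCount (H : Subgroup G) (x y : G) : star (conjCount H x y) = conjCount H x y := by
  simp [conjCount]

variable {N H : Subgroup G} [hN : N.Normal]

theorem conjCount_inv_inv (H : Subgroup G) (x y : G) :
    conjCount H x⁻¹ y⁻¹ = conjCount H x y := by
  rw [conjCount, conjCount]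
  refine Finset.sum_congr rfl fun t _ => ?_
  have h : t * x⁻¹ * (t : G)⁻¹ * y⁻¹ = 1 ↔ t * x * (t : G)⁻¹ * y = 1 := by
    rw [show t * x⁻¹ * (t : G)⁻¹ * y⁻¹ = (y * (t * x * (t : G)⁻¹))⁻¹ by group, inv_eq_one,
      mul_eq_one_iff_inv_eq, mul_eq_one_iff_eq_inv, eq_comm]
  simp only [h]

theorem diagKernel_inv_inv (N H : Subgroup G) [N.Normal] (x y : G) :
    diagKernel N H x⁻¹ y⁻¹ = diagKernel N H x y := by
  rw [diagKernel, diagKernel, conjCount_inv_inv, memInd_inv, memInd_inv, ← mul_inv_rev,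
    memInd_inv, memInd_mul_comm N y]

theorem star_diagKernel (N H : Subgroup G) (x y : G) :
    star (diagKernel N H x y) = diagKernel N H x y := by
  simp [diagKernel, star_memInd, star_conjCount, -Nat.card_eq_fintype_card, mul_comm]

namespace IsFrobeniusDecomposition

/-- On N × N the value is h + h³k − h³ at the identity pair, h + h²k − h³ on other conjugate pairs
and h − h³ on the rest; elsewhere it is h on conjugate pairs and 0 otherwise. Thus the sign detects
conjugacy. -/
theorem norm_diagKernel (hF : IsFrobeniusDecomposition N H) (x y : G) :
    (‖diagKernel N H x⁻¹ y‖ : ℂ) =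
      diagKernel N H x⁻¹ y * (2 * (if IsConj x y then 1 else 0) - 1) := by
  have hpos : ∀ {r : ℝ} {z : ℂ}, z = r → 0 ≤ r → (‖z‖ : ℂ) = z := fun {r z} h hr => by
    rw [h, Complex.norm_real, Real.norm_of_nonneg hr]
  have hneg : ∀ {r : ℝ} {z : ℂ}, z = r → r ≤ 0 → (‖z‖ : ℂ) = -z := fun {r z} h hr => by
    rw [h, Complex.norm_real, Real.norm_of_nonpos hr, Complex.ofReal_neg]
  have hh : (1 : ℝ) ≤ Nat.card H := by exact_mod_cast Nat.card_pos
  have hk : (Nat.card H : ℝ) ≤ Nat.card N := by exact_mod_cast hF.card_lt_card.le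
  have hS : diagKernel N H x⁻¹ y = Nat.card H * memInd N (x⁻¹ * y) + memInd N x * memInd N y *
    (Nat.card H ^ 2 * Nat.card N * conjCount H x⁻¹ y - Nat.card H ^ 3) := by
    rw [diagKernel, memInd_inv]
  have hI := hF.ite_isConj x y
  by_cases hxy : x ∈ N ∧ y ∈ N
  · obtain ⟨hx, hy⟩ := hxy
    rw [memInd_of_mem hx, memInd_of_mem hy, memInd_of_mem (N.mul_mem (N.inv_mem hx) hy)] at hS hI
    by_cases h : IsConj x y
    · rw [if_pos h] at hI ⊢
      by_cases h1 : x = 1 ∧ y = 1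
      · rw [if_pos h1.1, if_pos h1.2] at hI
        rw [hpos (r := Nat.card H + (Nat.card H ^ 2 * Nat.card N * Nat.card H - Nat.card H ^ 3))]
        · ring
        · rw [hS, show conjCount H x⁻¹ y = Nat.card H by linear_combination -hI]
          push_cast
          ring
        · have : (0 : ℝ) ≤ Nat.card H ^ 3 * (Nat.card N - 1) := by
            apply mul_nonneg (by positivity); linarith
          nlinarith
      · have h2 : ((if x = 1 then 1 else 0) * if y = 1 then 1 else 0 : ℂ) = 0 := by
          rw [ite_zero_mul_ite_zero, if_neg h1]
        rw [h2] at hI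
        rw [hpos (r := Nat.card H + (Nat.card H ^ 2 * Nat.card N - Nat.card H ^ 3))]
        · ring
        · rw [hS, show conjCount H x⁻¹ y = 1 by linear_combination -hI]
          push_cast
          ring
        -- Here h ≤ k is essential.
        · have : (0 : ℝ) ≤ Nat.card H ^ 2 * (Nat.card N - Nat.card H) := by
            apply mul_nonneg (by positivity); linarith
          nlinarith
    · rw [if_neg h] at hI ⊢
      have h2 : ((if x = 1 then 1 else 0) * if y = 1 then 1 else 0 : ℂ) = 0 := by
        rw [ite_zero_mul_ite_zero, if_neg]
        rintro ⟨rfl, rfl⟩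
        exact h (IsConj.refl 1)
      rw [h2] at hI
      rw [hneg (r := Nat.card H - Nat.card H ^ 3)]
      · ring
      · rw [hS, show conjCount H x⁻¹ y = 0 by linear_combination -hI]
        push_cast
        ring
      · have : (0 : ℝ) ≤ Nat.card H * (Nat.card H - 1) * (Nat.card H + 1) := by
          apply mul_nonneg (mul_nonneg (by positivity) (by linarith)) (by positivity)
        nlinarith
  · have h0 : memInd N x * memInd N y = 0 := by
      rw [mul_eq_zero]
      exact (not_and_or.1 hxy).imp memInd_of_notMem memInd_of_notMem
    rw [h0, zero_mul, add_zero] at hS hI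
    rw [hI, hS]
    by_cases h : x⁻¹ * y ∈ N
    · rw [memInd_of_mem h, hpos (r := Nat.card H) (by simp) (by positivity)]
      ring
    · simp [memInd_of_notMem h]

theorem sum_diagKernel_mul_isConj (hF : IsFrobeniusDecomposition N H) :
    ∑ x, ∑ y, diagKernel N H x⁻¹ y * (if IsConj x y then 1 else 0) =
      (Nat.card H : ℂ) ^ 2 * Nat.card N ^ 2 + (Nat.card H - Nat.card H ^ 3) *
        (Nat.card H * Nat.card N - (Nat.card H - 1)) +
        Nat.card H ^ 3 * Nat.card N ^ 2 - Nat.card H * Nat.card N ^ 2 := by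
  have hG : (Fintype.card G : ℂ) = Nat.card H * Nat.card N := by
    rw [← Nat.card_eq_fintype_card, hF.card_eq]
    push_cast
    rfl
  -- The product is rewritten as a linear combination of four functions whose double sums are known.
  have hterm : ∀ x y, diagKernel N H x⁻¹ y * (if IsConj x y then 1 else 0) =
      Nat.card H * memInd N (x⁻¹ * y) + (Nat.card H - Nat.card H ^ 3 + Nat.card H ^ 2 * Nat.card N) *
        (memInd N x * (memInd N y * conjCount H y x⁻¹)) - (Nat.card H - Nat.card H ^ 3) *
        (Nat.card H - 1) * ((if x = 1 then 1 else 0) * if y = 1 then 1 else 0) -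
        Nat.card H * (memInd N x * memInd N y) := by
    intro x y
    have hS : diagKernel N H x⁻¹ y = Nat.card H * memInd N (x⁻¹ * y) + memInd N x * memInd N y *
        (Nat.card H ^ 2 * Nat.card N * conjCount H x⁻¹ y - Nat.card H ^ 3) := by
      rw [diagKernel, memInd_inv]
    have hI := hF.ite_isConj x y
    rw [conjCount_comm H y]
    by_cases hxy : x ∈ N ∧ y ∈ N
    · obtain ⟨hx, hy⟩ := hxy
      rw [memInd_of_mem hx, memInd_of_mem hy, memInd_of_mem (N.mul_mem (N.inv_mem hx) hy)] at *
      rw [hS]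
      by_cases h : IsConj x y
      · rw [if_pos h] at hI ⊢
        linear_combination (Nat.card H - Nat.card H ^ 3 : ℂ) * hI
      · have h2 : ((if x = 1 then 1 else 0) * if y = 1 then 1 else 0 : ℂ) = 0 := by
          rw [ite_zero_mul_ite_zero, if_neg]
          rintro ⟨rfl, rfl⟩
          exact h (IsConj.refl 1)
        rw [if_neg h, h2] at hI
        rw [if_neg h, h2, show conjCount H x⁻¹ y = 0 by linear_combination -hI]
        ring
    · have h0 : memInd N x * memInd N y = 0 := by
        rw [mul_eq_zero]
        exact (not_and_or.1 hxy).imp memInd_of_notMem memInd_of_notMem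
      have h2 : ((if x = 1 then 1 else 0) * if y = 1 then 1 else 0 : ℂ) = 0 := by
        rw [ite_zero_mul_ite_zero, if_neg]
        rintro ⟨rfl, rfl⟩
        exact hxy ⟨N.one_mem, N.one_mem⟩
      rw [h0, zero_mul, add_zero] at hS hI
      rw [hI, hS, h2, h0, ← mul_assoc (memInd N x), h0]
      by_cases h : x⁻¹ * y ∈ N
      · rw [memInd_of_mem h]
        ring
      · rw [memInd_of_notMem h]
        ring
  have h1 : ∑ x, ∑ y, memInd N (x⁻¹ * y) = Nat.card H * Nat.card N * Nat.card N := by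
    have h : ∀ x, ∑ y, memInd N (x⁻¹ * y) = Nat.card N := fun x =>
      (Equiv.sum_comp (Equiv.mulLeft x⁻¹) (memInd N)).trans (sum_memInd N)
    rw [Finset.sum_congr rfl fun x _ => h x, Finset.sum_const, Finset.card_univ, nsmul_eq_mul, hG]
  have h2 : ∑ x, ∑ y, memInd N x * (memInd N y * conjCount H y x⁻¹) =
      Nat.card H * Nat.card N := by
    simp only [← Finset.mul_sum]
    rw [← sum_memInd N, Finset.mul_sum]
    refine Finset.sum_congr rfl fun x _ => ?_
    by_cases hx : x ∈ N
    · rw [sum_memInd_mul_conjCount H (N.inv_mem hx), mul_comm]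
    · simp [memInd_of_notMem hx]
  have h3 : ∑ x : G, ∑ y : G, ((if x = 1 then 1 else 0) * if y = 1 then 1 else 0 : ℂ) = 1 := by
    simp
  have h4 : ∑ x, ∑ y, memInd N x * memInd N y = (Nat.card N : ℂ) ^ 2 := by
    rw [← Finset.sum_mul_sum, sum_memInd, sq]
  have hsum : ∀ (A B C D : ℂ) (f₁ f₂ f₃ f₄ : G → G → ℂ),
      ∑ x, ∑ y, (A * f₁ x y + B * f₂ x y - C * f₃ x y - D * f₄ x y) =
        A * ∑ x, ∑ y, f₁ x y + B * ∑ x, ∑ y, f₂ x y - C * ∑ x, ∑ y, f₃ x y -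
          D * ∑ x, ∑ y, f₄ x y := fun A B C D f₁ f₂ f₃ f₄ => by
    simp only [Finset.mul_sum, ← Finset.sum_add_distrib, ← Finset.sum_sub_distrib]
  simp only [hterm]
  rw [hsum, h1, h2, h3, h4]
  ring

/-- The total sum of a tensor is that of its image under multiplication, here |G|²δ₁. -/
theorem sum_sum_diagKernel (hF : IsFrobeniusDecomposition N H) :
    ∑ x, ∑ y, diagKernel N H x⁻¹ y = ((Nat.card H : ℂ) * Nat.card N) ^ 2 := by
  calc _ = ∑ x, ∑ y, diagKernel N H x y :=
        Equiv.sum_comp (Equiv.inv G) fun x => ∑ y, diagKernel N H x y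
    _ = ∑ x, ∑ y, diagKernel N H x (x⁻¹ * y) :=
        Finset.sum_congr rfl fun x _ =>
          (Equiv.sum_comp (Equiv.mulLeft x⁻¹) (diagKernel N H x)).symm
    _ = _ := by
        rw [Finset.sum_comm]
        simp only [hF.sum_diagKernel]
        rw [Finset.sum_ite_eq' Finset.univ 1, if_pos (Finset.mem_univ _)]

end IsFrobeniusDecomposition

end DiagonalKernel

/-! ### The normalised kernel and the value of the constant. -/

section DiagonalKernel

open scoped Classical

variable {G : Type u} [Group G] [Fintype G] {N H : Subgroup G} [hN : N.Normal]

/-- The coefficients of the diagonal of `ZL¹(N ⋊ H)`. -/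
noncomputable def diagCoeff (N H : Subgroup G) (x y : G) : ℂ :=
  diagKernel N H x y / (Nat.card H * Nat.card N) ^ 2

namespace IsFrobeniusDecomposition

theorem isClassKernel_diagCoeff (hF : IsFrobeniusDecomposition N H) :
    IsClassKernel (diagCoeff N H) where
  left g x y := by rw [diagCoeff, hF.diagKernel_conj, diagCoeff]
  right g x y := by
    rw [diagCoeff, diagKernel_comm, hF.diagKernel_conj, diagKernel_comm, diagCoeff]

theorem sum_mul_diagCoeff (hF : IsFrobeniusDecomposition N H) (a : classFunctions G) (x y : G) :
    ∑ g, a.1 g * diagCoeff N H (g⁻¹ * x) y = ∑ g, a.1 g * diagCoeff N H x (g⁻¹ * y) := by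
  simp only [diagCoeff, ← mul_div_assoc, ← Finset.sum_div, hF.sum_mul_diagKernel]

theorem card_mul_card_sq_ne_zero (N H : Subgroup G) :
    ((Nat.card H : ℂ) * Nat.card N) ^ 2 ≠ 0 :=
  pow_ne_zero _ (mul_ne_zero (Nat.cast_ne_zero.2 Nat.card_pos.ne')
    (Nat.cast_ne_zero.2 Nat.card_pos.ne'))

theorem sum_diagCoeff (hF : IsFrobeniusDecomposition N H) (x : G) :
    ∑ g, diagCoeff N H g (g⁻¹ * x) = if x = 1 then 1 else 0 := by
  simp only [diagCoeff, ← Finset.sum_div, hF.sum_diagKernel]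
  split_ifs
  · exact div_self (card_mul_card_sq_ne_zero N H)
  · simp

theorem star_diagCoeff_inv_inv (N H : Subgroup G) [N.Normal] (x y : G) :
    star (diagCoeff N H x⁻¹ y⁻¹) = diagCoeff N H x y := by
  have h := star_diagKernel N H x y
  rw [diagCoeff, diagKernel_inv_inv, star_div₀, h, diagCoeff]
  simp [-Nat.card_eq_fintype_card]

/-- The common amenability constant of `ZL¹(N ⋊ H)` and `ZA(N ⋊ H)`. -/
noncomputable def constant (h k : ℝ) : ℝ :=
  1 + 2 * (h ^ 2 - 1) / h * (1 - (h - 1) / k) * (1 - 1 / k)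

theorem sum_diagCoeff_mul_isConj (hF : IsFrobeniusDecomposition N H) :
    2 * (∑ x, ∑ y, diagCoeff N H x⁻¹ y * (if IsConj x y then 1 else 0)) - 1 =
      (constant (Nat.card H) (Nat.card N) : ℂ) := by
  have h0 : (Nat.card H : ℂ) ≠ 0 := Nat.cast_ne_zero.2 Nat.card_pos.ne'
  have k0 : (Nat.card N : ℂ) ≠ 0 := Nat.cast_ne_zero.2 Nat.card_pos.ne'
  simp only [diagCoeff, div_mul_eq_mul_div, ← Finset.sum_div, hF.sum_diagKernel_mul_isConj,
    constant]
  push_cast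
  field_simp
  ring

/-- By the sign rule the ℓ¹-norm is 2S minus the total sum 1, S being the sum over conjugate pairs.
-/
theorem sum_norm_diagCoeff (hF : IsFrobeniusDecomposition N H) :
    ∑ x, ∑ y, ‖diagCoeff N H x y‖ = constant (Nat.card H) (Nat.card N) := by
  rw [← Complex.ofReal_inj, ← hF.sum_diagCoeff_mul_isConj]
  push_cast
  have h1 : ∀ x y, (‖diagCoeff N H x⁻¹ y‖ : ℂ) =
      diagCoeff N H x⁻¹ y * (2 * (if IsConj x y then 1 else 0) - 1) := fun x y => by
    rw [diagCoeff, norm_div, Complex.ofReal_div, hF.norm_diagKernel]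
    simp [-Nat.card_eq_fintype_card]
    ring
  have h2 : ∑ x, ∑ y, diagCoeff N H x⁻¹ y = 1 := by
    simp only [diagCoeff, ← Finset.sum_div, hF.sum_sum_diagKernel]
    exact div_self (card_mul_card_sq_ne_zero N H)
  calc _ = ∑ x, ∑ y, (‖diagCoeff N H x⁻¹ y‖ : ℂ) :=
        (Equiv.sum_comp (Equiv.inv G) fun x => ∑ y, (‖diagCoeff N H x y‖ : ℂ)).symm
    _ = 2 * (∑ x, ∑ y, diagCoeff N H x⁻¹ y * (if IsConj x y then 1 else 0)) -
          ∑ x, ∑ y, diagCoeff N H x⁻¹ y := by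
        simp only [h1, Finset.mul_sum, ← Finset.sum_sub_distrib]
        exact Finset.sum_congr rfl fun x _ => Finset.sum_congr rfl fun y _ => by ring
    _ = _ := by rw [h2]

theorem amenabilityConstant_ZL1_eq (hF : IsFrobeniusDecomposition N H) :
    amenabilityConstant (ZL1 G) = ENNReal.ofReal (constant (Nat.card H) (Nat.card N)) := by
  rw [amenabilityConstant_ZL1 hF.isClassKernel_diagCoeff hF.sum_mul_diagCoeff hF.sum_diagCoeff,
    hF.sum_norm_diagCoeff]

theorem amenabilityConstant_ZA_eq (hF : IsFrobeniusDecomposition N H)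
    (ω : ZA G ⊗[ℂ] ZA G)
    (hω : ∀ x y, tensorEval (centralFourierEquiv G) x y ω = if IsConj x y then 1 else 0)
    (hV : projectiveNorm ω ≤ constant (Nat.card H) (Nat.card N)) :
    amenabilityConstant (ZA G) = ENNReal.ofReal (constant (Nat.card H) (Nat.card N)) := by
  refine amenabilityConstant_ZA
    (fun x y => 2 * diagCoeff N H x⁻¹ y - if (x, y) = 1 then (1 : ℂ) else 0)
    (norm_leftRegularOp_kernel_le hF.isClassKernel_diagCoeff hF.sum_mul_diagCoeff
      hF.sum_diagCoeff (star_diagCoeff_inv_inv N H)) ?_ ω hω hV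
  rw [← hF.sum_diagCoeff_mul_isConj]
  -- The δ part of the reflection meets the conjugacy indicator only at (1, 1), so the pairing is
  -- again 2S − 1.
  have h1 : ∑ x : G, ∑ y : G, (if (x, y) = 1 then (1 : ℂ) else 0) *
      (if IsConj x y then 1 else 0) = 1 := by
    rw [← Fintype.sum_prod_type (f := fun p : G × G => (if p = 1 then (1 : ℂ) else 0) *
      (if IsConj p.1 p.2 then 1 else 0)), Finset.sum_eq_single 1]
    · rw [if_pos rfl]
      exact (one_mul _).trans (if_pos (IsConj.refl (1 : G)))
    · intro p _ hp
      rw [if_neg hp, zero_mul]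
    · simp
  simp only [sub_mul, Finset.sum_sub_distrib, h1, Finset.mul_sum, mul_assoc]

end IsFrobeniusDecomposition

end DiagonalKernel

/-! ### Characters of finite abelian groups. -/

section CharactersOfAbelianGroups

variable {A : Type*} [Group A] [Finite A]

theorem norm_monoidHom_apply (φ : A →* ℂ) (a : A) : ‖φ a‖ = 1 :=
  (φ.isOfFinOrder (isOfFinOrder_of_finite a)).norm_eq_one

theorem exists_characterFintype (hA : ∀ a b : A, a * b = b * a) :
    ∃ _ : Fintype (A →* ℂ), Fintype.card (A →* ℂ) = Nat.card A ∧
      ∀ a : A, a ≠ 1 → ∑ φ : A →* ℂ, φ a = 0 := by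
  classical
  have := Fintype.ofFinite A
  let _ : CommGroup A := { (inferInstance : Group A) with mul_comm := hA }
  let e : AddChar (Additive A) ℂ ≃ (A →* ℂ) := AddChar.toMonoidHomEquiv
  refine ⟨Fintype.ofEquiv _ e, ?_, fun a ha => ?_⟩
  · let _ : Fintype (A →* ℂ) := Fintype.ofEquiv _ e
    rw [← Fintype.card_congr e, AddChar.card_eq, Nat.card_eq_fintype_card]
    exact Fintype.card_congr Additive.toMul
  · let _ : Fintype (A →* ℂ) := Fintype.ofEquiv _ e
    rw [← Equiv.sum_comp e]
    exact (AddChar.sum_apply_eq_ite (Additive.ofMul a)).trans (if_neg ha)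

end CharactersOfAbelianGroups

/-! ### Characters of N ⋊ H induced from N. -/

section InducedCharacters

open scoped Classical

variable {G : Type u} [Group G] [Fintype G] {N H : Subgroup G}

theorem fourierNorm_sum_le {ι : Type*} [Fintype ι] (u : ι → G → ℂ) :
    fourierNorm (fun x => ∑ i, u i x) ≤ ∑ i, fourierNorm (u i) := by
  have : Nonempty {f : G → ℂ // ‖leftRegularOp f‖ ≤ 1} := ⟨0, by simp [leftRegularOp_zero]⟩
  refine ciSup_le fun f => ?_
  simp only [Finset.mul_sum]
  rw [Finset.sum_comm]
  exact norm_sum_le_of_le _ fun i _ => le_ciSup (fourierNorm_bddAbove (u i)) f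

/-- A character of a subgroup, extended by zero. -/
noncomputable def extendChar (θ : N →* ℂ) (x : G) : ℂ := if h : x ∈ N then θ ⟨x, h⟩ else 0

omit [Fintype G] in
theorem extendChar_of_mem (θ : N →* ℂ) {x : G} (h : x ∈ N) : extendChar θ x = θ ⟨x, h⟩ :=
  dif_pos h

omit [Fintype G] in
theorem extendChar_of_notMem (θ : N →* ℂ) {x : G} (h : x ∉ N) : extendChar θ x = 0 :=
  dif_neg h

omit [Fintype G] in
theorem extendChar_one (x : G) : extendChar (1 : N →* ℂ) x = memInd N x := by
  simp [extendChar, memInd]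

omit [Fintype G] in
theorem extendChar_mul (θ : N →* ℂ) {x y : G} (hx : x ∈ N) (hy : y ∈ N) :
    extendChar θ (x * y) = extendChar θ x * extendChar θ y := by
  rw [extendChar_of_mem θ hx, extendChar_of_mem θ hy, extendChar_of_mem θ (N.mul_mem hx hy),
    ← map_mul]
  rfl

theorem norm_extendChar (θ : N →* ℂ) {x : G} (hx : x ∈ N) : ‖extendChar θ x‖ = 1 := by
  rw [extendChar_of_mem θ hx, norm_monoidHom_apply]

variable [hN : N.Normal]

/-- The character of `N ⋊ H` induced from a character of `N`. -/
noncomputable def inducedChar (H : Subgroup G) (θ : N →* ℂ) (x : G) : ℂ :=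
  ∑ t : H, extendChar θ (t * x * (t : G)⁻¹)

omit [Fintype G] in
theorem conj_mem_iff_of_normal {N : Subgroup G} [hN : N.Normal] (g x : G) :
    g * x * g⁻¹ ∈ N ↔ x ∈ N :=
  ⟨fun h => by simpa [mul_assoc] using hN.conj_mem _ h g⁻¹, fun h => hN.conj_mem _ h g⟩

theorem inducedChar_of_notMem (H : Subgroup G) (θ : N →* ℂ) {x : G} (hx : x ∉ N) :
    inducedChar H θ x = 0 :=
  Finset.sum_eq_zero fun t _ =>
    extendChar_of_notMem θ (mt (conj_mem_iff_of_normal (t : G) x).1 hx)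

/-- The conjugate of a character of a normal subgroup. -/
noncomputable def conjChar (t : G) (θ : N →* ℂ) : N →* ℂ :=
  θ.comp (MulAut.conjNormal t).toMonoidHom

omit [Fintype G] in
theorem extendChar_conjChar (t : G) (θ : N →* ℂ) (x : G) :
    extendChar (conjChar t θ) x = extendChar θ (t * x * t⁻¹) := by
  by_cases hx : x ∈ N
  · rw [extendChar_of_mem _ hx, extendChar_of_mem _ (hN.conj_mem x hx t)]
    rfl
  · rw [extendChar_of_notMem _ hx, extendChar_of_notMem _ (mt (conj_mem_iff_of_normal t x).1 hx)]

theorem inducedChar_conjChar (θ : N →* ℂ) (s : H) (x : G) :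
    inducedChar H (conjChar (s : G) θ) x = inducedChar H θ x := by
  rw [inducedChar, inducedChar, ← Equiv.sum_comp (Equiv.mulLeft s)
    fun t : H => extendChar θ (t * x * (t : G)⁻¹)]
  refine Finset.sum_congr rfl fun t _ => ?_
  rw [extendChar_conjChar]
  simp [mul_assoc]

/-- Each of the h summands is a unitary character of N extended by zero. -/
theorem fourierNorm_inducedChar_le (H : Subgroup G) (θ : N →* ℂ) :
    fourierNorm (inducedChar H θ) ≤ Nat.card H := by
  refine (fourierNorm_sum_le fun (t : H) (x : G) => extendChar θ (t * x * (t : G)⁻¹)).trans ?_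
  rw [Nat.card_eq_fintype_card, ← nsmul_one, ← Finset.card_univ, ← Finset.sum_const]
  refine Finset.sum_le_sum fun t _ => ?_
  refine fourierNorm_le_one_of_character N _ (fun x hx => ?_) (fun x hx => ?_)
    fun x hx y hy => ?_
  · exact extendChar_of_notMem θ (mt (conj_mem_iff_of_normal (t : G) x).1 hx)
  · exact norm_extendChar θ (hN.conj_mem x hx t)
  · rw [← extendChar_mul θ (hN.conj_mem x hx t) (hN.conj_mem y hy t)]
    congr 1
    group

theorem fourierNorm_inducedChar_inv_le (H : Subgroup G) (θ : N →* ℂ) :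
    fourierNorm (fun x => inducedChar H θ x⁻¹) ≤ Nat.card H := by
  refine (fourierNorm_sum_le fun (t : H) (x : G) => extendChar θ (t * x⁻¹ * (t : G)⁻¹)).trans ?_
  rw [Nat.card_eq_fintype_card, ← nsmul_one, ← Finset.card_univ, ← Finset.sum_const]
  refine Finset.sum_le_sum fun t _ => ?_
  refine fourierNorm_le_one_of_character N _ (fun x hx => ?_) (fun x hx => ?_)
    fun x hx y hy => ?_
  · exact extendChar_of_notMem θ
      (mt (conj_mem_iff_of_normal (t : G) x⁻¹).1 (mt N.inv_mem_iff.1 hx))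
  · exact norm_extendChar θ (hN.conj_mem _ (N.inv_mem hx) t)
  · rw [mul_comm (extendChar θ _), ← extendChar_mul θ (hN.conj_mem _ (N.inv_mem hy) t)
      (hN.conj_mem _ (N.inv_mem hx) t)]
    congr 1
    group

theorem IsFrobeniusDecomposition.inducedChar_conj (hF : IsFrobeniusDecomposition N H) (θ : N →* ℂ) (g x : G) :
    inducedChar H θ (g * x * g⁻¹) = inducedChar H θ x := by
  by_cases hx : x ∈ N
  · obtain ⟨s, hs, h⟩ := (hF.isConj_iff_of_mem hx).1 (isConj_iff.2 ⟨g, rfl⟩)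
    rw [← h, inducedChar, inducedChar, ← Equiv.sum_comp (Equiv.mulRight (⟨s, hs⟩ : H)⁻¹)]
    exact Finset.sum_congr rfl fun t _ => by simp [mul_assoc]
  · rw [inducedChar_of_notMem H θ hx,
      inducedChar_of_notMem H θ (mt (conj_mem_iff_of_normal g x).1 hx)]

/-- A character of `N ⋊ H` trivial on `N`. -/
noncomputable def quotientChar (φ : G ⧸ N →* ℂ) : classFunctions G :=
  ⟨fun x => φ x, fun x y => by
    simp only [QuotientGroup.mk_mul, map_mul]
    rw [mul_comm, ← mul_assoc, ← map_mul, ← QuotientGroup.mk_mul]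
    simp⟩

/-- If two conjugates of θ agree, θ is invariant under some r outside N, hence trivial on the
commutators rnr⁻¹n⁻¹, which exhaust N. So H acts freely on the non-trivial characters of N. -/
theorem IsFrobeniusDecomposition.conjChar_injective (hF : IsFrobeniusDecomposition N H) {θ : N →* ℂ} (hθ : θ ≠ 1) :
    Function.Injective fun t : H => conjChar (t : G) θ := by
  intro s t hst
  by_contra hne
  apply hθ
  have hst' : ∀ x, extendChar θ (s * x * (s : G)⁻¹) = extendChar θ (t * x * (t : G)⁻¹) := fun x => by
    rw [← extendChar_conjChar, ← extendChar_conjChar]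
    exact congrArg (fun θ => extendChar θ x) hst
  have hr : (s * (t : G)⁻¹) ∉ N := fun h => hne <| Subtype.ext <| mul_inv_eq_one.1 <|
    hF.disjoint _ h (H.mul_mem s.2 (H.inv_mem t.2))
  ext ⟨y, hy⟩
  obtain ⟨n, ⟨hn, h⟩, -⟩ := hF.existsUnique_commutator hr hy
  rw [MonoidHom.one_apply, ← extendChar_of_mem θ hy]
  have hc := hN.conj_mem n hn (s * (t : G)⁻¹)
  have h1 : extendChar θ (s * (t : G)⁻¹ * n * (s * (t : G)⁻¹)⁻¹) = extendChar θ n := by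
    have h2 := hst' ((t : G)⁻¹ * n * t)
    simpa [mul_assoc] using h2
  have h3 := extendChar_mul θ hy hn
  rw [← h, inv_mul_cancel_right, h1, h] at h3
  have h4 : extendChar θ n ≠ 0 := fun h0 => by simpa [h0] using norm_extendChar θ hn
  exact (mul_eq_right₀ h4).1 h3.symm

omit [Fintype G] in
theorem conjChar_ne_one {θ : N →* ℂ} (hθ : θ ≠ 1) (t : G) : conjChar t θ ≠ 1 := by
  intro h
  apply hθ
  ext x
  obtain ⟨y, rfl⟩ := (MulAut.conjNormal t : N ≃* N).surjective x
  exact DFunLike.congr_fun h y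

theorem IsFrobeniusDecomposition.card_filter_conjChar [Fintype (N →* ℂ)] (hF : IsFrobeniusDecomposition N H)
    {θ : N →* ℂ} (hθ : θ ≠ 1) :
    (Finset.univ.filter fun θ' : {θ : N →* ℂ // θ ≠ 1} =>
      ∃ t : H, conjChar (t : G) θ = θ'.1).card = Nat.card H := by
  rw [Nat.card_eq_fintype_card, ← Finset.card_univ,
    ← Finset.card_image_of_injective (Finset.univ : Finset H)
      (f := fun t : H => (⟨conjChar (t : G) θ, conjChar_ne_one hθ t⟩ : {θ : N →* ℂ // θ ≠ 1}))
      fun s t h => hF.conjChar_injective hθ (congrArg Subtype.val h)]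
  congr 1
  ext θ'
  simp [Subtype.ext_iff]

omit [Fintype G] hN in
theorem sum_extendChar [Fintype (N →* ℂ)] (hcard : Fintype.card (N →* ℂ) = Nat.card N)
    (hsum : ∀ a : N, a ≠ 1 → ∑ φ : N →* ℂ, φ a = 0) (x : G) :
    ∑ θ : N →* ℂ, extendChar θ x = if x = 1 then (Nat.card N : ℂ) else 0 := by
  by_cases hx : x ∈ N
  · simp only [extendChar_of_mem _ hx]
    split_ifs with h
    · subst h
      rw [← hcard]
      simp [show (⟨1, hx⟩ : N) = 1 from rfl]
    · exact hsum ⟨x, hx⟩ (by simpa [Subtype.ext_iff] using h)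
  · rw [if_neg (by rintro rfl; exact hx N.one_mem)]
    exact Finset.sum_eq_zero fun θ _ => extendChar_of_notMem θ hx

theorem sum_inducedChar [Fintype (N →* ℂ)] (hcard : Fintype.card (N →* ℂ) = Nat.card N)
    (hsum : ∀ a : N, a ≠ 1 → ∑ φ : N →* ℂ, φ a = 0) (x : G) :
    ∑ θ : {θ : N →* ℂ // θ ≠ 1}, inducedChar H θ.1 x =
      Nat.card H * (Nat.card N * (if x = 1 then 1 else 0) - memInd N x) := by
  have h1 : ∑ θ : N →* ℂ, inducedChar H θ x =
      Nat.card H * (Nat.card N * (if x = 1 then 1 else 0)) := by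
    simp only [inducedChar]
    rw [Finset.sum_comm]
    simp only [sum_extendChar hcard hsum, conj_eq_one_iff, Finset.sum_const, Finset.card_univ,
      nsmul_eq_mul, Nat.card_eq_fintype_card (α := H), mul_ite, mul_one, mul_zero]
  have h2 : inducedChar H (1 : N →* ℂ) x = Nat.card H * memInd N x := by
    simp [inducedChar, extendChar_one, memInd_conj, Nat.card_eq_fintype_card]
  rw [mul_sub, ← h1, ← h2, Fintype.sum_eq_add_sum_subtype_ne _ (1 : N →* ℂ), add_sub_cancel_left]

/-- Orthogonality on N counts the pairs (s, t) with sxs⁻¹ = tyt⁻¹; the trivial character contributes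
the subtracted h². -/
theorem sum_inducedChar_mul [Fintype (N →* ℂ)] (hcard : Fintype.card (N →* ℂ) = Nat.card N)
    (hsum : ∀ a : N, a ≠ 1 → ∑ φ : N →* ℂ, φ a = 0) (x y : G) :
    ∑ θ : {θ : N →* ℂ // θ ≠ 1}, inducedChar H θ.1 x * inducedChar H θ.1 y⁻¹ =
      memInd N x * memInd N y * (Nat.card H * Nat.card N * conjCount H x⁻¹ y - Nat.card H ^ 2) := by
  by_cases hx : x ∈ N
  swap
  · simp [memInd_of_notMem hx, inducedChar_of_notMem H _ hx]
  by_cases hy : y ∈ N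
  swap
  · simp [memInd_of_notMem hy, inducedChar_of_notMem H _ (mt N.inv_mem_iff.1 hy)]
  have h1 : ∑ θ : N →* ℂ, inducedChar H θ x * inducedChar H θ y⁻¹ =
      Nat.card H * Nat.card N * conjCount H x⁻¹ y := by
    have hmul : ∀ (θ : N →* ℂ) (s t : H), extendChar θ (s * x * (s : G)⁻¹) *
        extendChar θ (t * y⁻¹ * (t : G)⁻¹) =
        extendChar θ (s * x * (s : G)⁻¹ * (t * y⁻¹ * (t : G)⁻¹)) := fun θ s t =>
      (extendChar_mul θ (hN.conj_mem x hx s) (hN.conj_mem _ (N.inv_mem hy) t)).symm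
    simp only [inducedChar, Finset.sum_mul_sum, hmul]
    rw [Finset.sum_comm, Finset.sum_congr rfl fun s _ => Finset.sum_comm]
    simp only [sum_extendChar hcard hsum]
    rw [Finset.sum_comm, ← conjCount_inv_inv, inv_inv, conjCount, mul_assoc,
      Nat.card_eq_fintype_card (α := H), ← nsmul_eq_mul, ← Finset.card_univ, ← Finset.sum_const]
    refine Finset.sum_congr rfl fun t _ => ?_
    -- After s ↦ ts the condition no longer involves t, whence one factor h.
    rw [← Equiv.sum_comp (Equiv.mulLeft t), Finset.mul_sum]
    refine Finset.sum_congr rfl fun s _ => ?_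
    have h : (t * s : G) * x * (t * s : G)⁻¹ * (t * y⁻¹ * (t : G)⁻¹) = 1 ↔
        s * x * (s : G)⁻¹ * y⁻¹ = 1 := by
      rw [← conj_eq_one_iff (a := (t : G)) (b := s * x * (s : G)⁻¹ * y⁻¹)]
      simp [mul_assoc]
    simp only [Equiv.coe_mulLeft, Subgroup.coe_mul, h, mul_ite, mul_one, mul_zero]
  have h2 : ∀ x, inducedChar H (1 : N →* ℂ) x = Nat.card H * memInd N x := fun x => by
    simp [inducedChar, extendChar_one, memInd_conj, Nat.card_eq_fintype_card]
  rw [memInd_of_mem hx, memInd_of_mem hy, ← h1, Fintype.sum_eq_add_sum_subtype_ne _ (1 : N →* ℂ),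
    h2, h2, memInd_inv, memInd_of_mem hx, memInd_of_mem hy]
  ring

omit hN in
theorem IsFrobeniusDecomposition.card_quotient (hF : IsFrobeniusDecomposition N H) : Nat.card (G ⧸ N) = Nat.card H := by
  have h := N.card_mul_index
  rw [hF.card_eq, mul_comm (Nat.card H)] at h
  exact Nat.eq_of_mul_eq_mul_left Nat.card_pos h

theorem IsFrobeniusDecomposition.sum_quotientChar [Fintype (G ⧸ N →* ℂ)] (hF : IsFrobeniusDecomposition N H)
    (hcard : Fintype.card (G ⧸ N →* ℂ) = Nat.card (G ⧸ N))
    (hsum : ∀ a : G ⧸ N, a ≠ 1 → ∑ φ : G ⧸ N →* ℂ, φ a = 0) (x : G) :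
    ∑ φ : G ⧸ N →* ℂ, φ x = Nat.card H * memInd N x := by
  by_cases hx : x ∈ N
  · rw [(QuotientGroup.eq_one_iff x).2 hx, memInd_of_mem hx]
    simp only [map_one, Finset.sum_const, Finset.card_univ, hcard]
    rw [nsmul_one, mul_one, hF.card_quotient]
  · rw [hsum _ (mt (QuotientGroup.eq_one_iff x).1 hx), memInd_of_notMem hx, mul_zero]

end InducedCharacters

/-! ### The diagonal of ZA(G) in irreducible characters. -/

section DiagonalOfZA

open scoped Classical

theorem sum_sum_add_ite_mul {ι R : Type*} [Fintype ι] [CommRing R] (r : ι → ι → Prop)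
    [∀ i j, Decidable (r i j)] (α β : R)
    (u v : ι → R) :
    ∑ i, ∑ j, (α + if r i j then β else 0) * (u i * v j) =
      α * ((∑ i, u i) * ∑ j, v j) + β * ∑ i, u i * ∑ j, if r i j then v j else 0 := by
  rw [Finset.sum_mul_sum]
  simp only [Finset.mul_sum, ← Finset.sum_add_distrib]
  refine Finset.sum_congr rfl fun i _ => Finset.sum_congr rfl fun j _ => ?_
  split_ifs <;> ring

/-- Absolute values keep the shape "constant plus indicator", so `sum_sum_add_ite_mul` serves for
the coefficients and for their moduli. -/
theorem abs_add_ite {p : Prop} [Decidable p] {α β : ℝ} (hα : α ≤ 0) (hβ : 0 ≤ α + β) :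
    |α + if p then β else 0| = -α + if p then β + 2 * α else 0 := by
  split_ifs
  · rw [abs_of_nonneg hβ]
    ring
  · rw [add_zero, abs_of_nonpos hα, add_zero]

variable {G : Type u} [Group G] [Fintype G] {N H : Subgroup G} [hN : N.Normal]

theorem fourierNorm_quotientChar_le (φ : G ⧸ N →* ℂ) : fourierNorm (quotientChar φ).1 ≤ 1 :=
  fourierNorm_le_one_of_character ⊤ _ (fun _ hx => (hx trivial).elim)
    (fun x _ => norm_monoidHom_apply φ x) fun x _ y _ => map_mul φ (x : G ⧸ N) y

theorem fourierNorm_quotientChar_inv_le (φ : G ⧸ N →* ℂ) :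
    fourierNorm (fun x => (quotientChar φ).1 x⁻¹) ≤ 1 :=
  fourierNorm_le_one_of_character ⊤ _ (fun _ hx => (hx trivial).elim)
    (fun x _ => norm_monoidHom_apply φ (x⁻¹ : G)) fun x _ y _ => by
      simp [quotientChar, mul_comm]

/-- The class function `x ↦ u(x⁻¹)`. -/
def classFunctionInv (u : classFunctions G) : classFunctions G :=
  ⟨fun x => u.1 x⁻¹, fun x y => by
    beta_reduce
    rw [← u.2 x y⁻¹]
    simp [mul_assoc]⟩

namespace IsFrobeniusDecomposition

/-- The irreducible characters of `N ⋊ H`, with repetitions. -/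
noncomputable def irrChar (hF : IsFrobeniusDecomposition N H) :
    (G ⧸ N →* ℂ) ⊕ {θ : N →* ℂ // θ ≠ 1} → classFunctions G :=
  Sum.elim quotientChar fun θ => ⟨inducedChar H θ.1, hF.inducedChar_conj θ.1⟩

/-- The degrees of the irreducible characters of `N ⋊ H`. -/
noncomputable def irrDegree (N H : Subgroup G) [N.Normal] :
    (G ⧸ N →* ℂ) ⊕ {θ : N →* ℂ // θ ≠ 1} → ℝ :=
  Sum.elim (fun _ => 1) fun _ => Nat.card H

/-- The coefficients of the diagonal of `ZA(N ⋊ H)` in the irreducible characters, up to the factor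
`|G|²`. -/
noncomputable def irrCoeff (N H : Subgroup G) [N.Normal]
    (i j : (G ⧸ N →* ℂ) ⊕ {θ : N →* ℂ // θ ≠ 1}) : ℝ :=
  match i, j with
  -- Each coefficient is the sum over x of |class of x|·χ̄(x)ψ(x). Here 1 + (k − 1)h comes from N,
  -- and the cosets outside N, with classes of size k, give k²(h·[φ = φ'] − 1).
  | .inl φ, .inl φ' => (1 + (Nat.card N - 1) * Nat.card H - Nat.card N ^ 2) +
      if φ = φ' then (Nat.card H : ℝ) * Nat.card N ^ 2 else 0
  -- The coefficient h(1 − h) is spread evenly over the h characters θ inducing the same character.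
  | .inl _, .inr _ => 1 - Nat.card H
  | .inr _, .inl _ => 1 - Nat.card H
  -- The coefficient h² − h³ + h²k·[same orbit] is spread over the h² pairs of repetitions, all with
  -- one sign, so nothing is lost in absolute value.
  | .inr θ, .inr θ' => (1 - Nat.card H) +
      if ∃ t : H, conjChar (t : G) θ.1 = θ'.1 then (Nat.card N : ℝ) else 0

theorem fourierNorm_irrChar_le (hF : IsFrobeniusDecomposition N H)
    (i : (G ⧸ N →* ℂ) ⊕ {θ : N →* ℂ // θ ≠ 1}) :
    fourierNorm (hF.irrChar i).1 ≤ irrDegree N H i := by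
  cases i with
  | inl φ => exact fourierNorm_quotientChar_le φ
  | inr θ => exact fourierNorm_inducedChar_le H θ.1

theorem fourierNorm_irrChar_inv_le (hF : IsFrobeniusDecomposition N H)
    (i : (G ⧸ N →* ℂ) ⊕ {θ : N →* ℂ // θ ≠ 1}) :
    fourierNorm (classFunctionInv (hF.irrChar i)).1 ≤ irrDegree N H i := by
  cases i with
  | inl φ => exact fourierNorm_quotientChar_inv_le φ
  | inr θ => exact fourierNorm_inducedChar_inv_le H θ.1

variable [Fintype (G ⧸ N →* ℂ)] [Fintype (N →* ℂ)]

theorem sum_irrCoeff_mul_irrChar (hF : IsFrobeniusDecomposition N H)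
    (hcardQ : Fintype.card (G ⧸ N →* ℂ) = Nat.card (G ⧸ N))
    (hsumQ : ∀ a : G ⧸ N, a ≠ 1 → ∑ φ : G ⧸ N →* ℂ, φ a = 0)
    (hcard : Fintype.card (N →* ℂ) = Nat.card N)
    (hsum : ∀ a : N, a ≠ 1 → ∑ φ : N →* ℂ, φ a = 0) (x y : G) :
    ∑ i, ∑ j, (irrCoeff N H i j : ℂ) *
      ((hF.irrChar i).1 x * (classFunctionInv (hF.irrChar j)).1 y) =
      (Nat.card H * Nat.card N) ^ 2 * if IsConj x y then 1 else 0 := by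
  have hQ := hF.sum_quotientChar hcardQ hsumQ
  have hI := sum_inducedChar (H := H) hcard hsum
  have hII := sum_inducedChar_mul (H := H) hcard hsum x y
  have hQQ : ∑ φ : G ⧸ N →* ℂ, φ x * φ (y⁻¹ : G) = Nat.card H * memInd N (x⁻¹ * y) := by
    have h := hQ (x * y⁻¹)
    simp only [QuotientGroup.mk_mul, map_mul] at h
    rw [h, memInd_mul_comm, ← memInd_inv, mul_inv_rev, inv_inv]
  have hdelta : ∀ x : G, memInd N x * (if x = 1 then 1 else 0 : ℂ) = if x = 1 then 1 else 0 := by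
    intro x
    split_ifs with h
    · rw [h, memInd_of_mem N.one_mem, mul_one]
    · rw [mul_zero]
  simp only [Fintype.sum_sum_type, irrCoeff, irrChar, classFunctionInv, Sum.elim_inl, Sum.elim_inr,
    quotientChar, Finset.sum_add_distrib]
  simp only [Complex.ofReal_add, apply_ite Complex.ofReal]
  push_cast
  rw [sum_sum_add_ite_mul, sum_sum_add_ite_mul]
  simp only [Finset.sum_ite_eq, Finset.mem_univ, if_true]
  -- All h characters in an orbit induce the same character.
  have horbit : ∀ θ : {θ : N →* ℂ // θ ≠ 1}, (∑ θ' : {θ : N →* ℂ // θ ≠ 1},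
      if ∃ t : H, conjChar (t : G) θ.1 = θ'.1 then inducedChar H θ'.1 y⁻¹ else 0) =
      Nat.card H * inducedChar H θ.1 y⁻¹ := fun θ => by
    rw [← Finset.sum_filter, ← hF.card_filter_conjChar θ.2, ← nsmul_eq_mul, ← Finset.sum_const]
    refine Finset.sum_congr rfl fun θ' h => ?_
    obtain ⟨t, ht⟩ := (Finset.mem_filter.1 h).2
    rw [← ht, inducedChar_conjChar]
  simp only [horbit, mul_left_comm _ (Nat.card H : ℂ)]
  simp only [← Finset.mul_sum, ← Finset.sum_mul]
  have hd : memInd N x * memInd N y * ((if x = 1 then 1 else 0) * if y = 1 then 1 else 0) =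
      ((if x = 1 then 1 else 0) * if y = 1 then 1 else 0 : ℂ) := by
    rw [mul_mul_mul_comm, hdelta, hdelta]
  rw [hQ, hQ, hQQ, hI, hI, hII, hF.ite_isConj, memInd_inv]
  simp only [inv_eq_one]
  linear_combination ((Nat.card H : ℂ) - 1) * Nat.card H ^ 2 * Nat.card N ^ 2 * hd

/-- The coefficients are non-positive except for φ = φ' or θ, θ' in one orbit, where they are
non-negative; this removes the absolute values. -/
theorem sum_irrCoeff_mul_irrDegree (hF : IsFrobeniusDecomposition N H)
    (hcardQ : Fintype.card (G ⧸ N →* ℂ) = Nat.card (G ⧸ N))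
    (hcard : Fintype.card (N →* ℂ) = Nat.card N) :
    ∑ i, ∑ j, |irrCoeff N H i j| * (irrDegree N H i * irrDegree N H j) =
      (Nat.card H * Nat.card N) ^ 2 * constant (Nat.card H) (Nat.card N) := by
  have hh : (1 : ℝ) ≤ Nat.card H := by exact_mod_cast Nat.card_pos
  have hk : (Nat.card H : ℝ) + 1 ≤ Nat.card N := by exact_mod_cast hF.card_lt_card
  have hΛ : (Fintype.card (G ⧸ N →* ℂ) : ℝ) = Nat.card H := by rw [hcardQ, hF.card_quotient]
  have hΘ : (Fintype.card {θ : N →* ℂ // θ ≠ 1} : ℝ) = Nat.card N - 1 := by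
    rw [Fintype.card_subtype_compl, hcard]
    simp [-Nat.card_eq_fintype_card, Nat.cast_pred Nat.card_pos]
  have h1 : |1 - (Nat.card H : ℝ)| = Nat.card H - 1 := by
    rw [abs_of_nonpos (by linarith)]
    ring
  -- Since h ≤ k − 1, the left side is at most 2 − 2k.
  have h2 : (1 + (Nat.card N - 1) * Nat.card H - Nat.card N ^ 2 : ℝ) ≤ 0 := by nlinarith
  have h3 : (0 : ℝ) ≤ (1 + (Nat.card N - 1) * Nat.card H - Nat.card N ^ 2) +
      Nat.card H * Nat.card N ^ 2 := by nlinarith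
  have horbit : ∀ θ : {θ : N →* ℂ // θ ≠ 1}, (∑ θ' : {θ : N →* ℂ // θ ≠ 1},
      if ∃ t : H, conjChar (t : G) θ.1 = θ'.1 then (Nat.card H : ℝ) else 0) =
      Nat.card H * Nat.card H := fun θ => by
    rw [← Finset.sum_filter, Finset.sum_const, hF.card_filter_conjChar θ.2, nsmul_eq_mul]
  simp only [Fintype.sum_sum_type, irrCoeff, irrDegree, Sum.elim_inl, Sum.elim_inr,
    Finset.sum_add_distrib, h1, abs_add_ite h2 h3,
    abs_add_ite (show (1 - Nat.card H : ℝ) ≤ 0 by linarith)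
      (show (0 : ℝ) ≤ 1 - Nat.card H + Nat.card N by linarith)]
  rw [sum_sum_add_ite_mul, sum_sum_add_ite_mul]
  simp only [Finset.sum_ite_eq, Finset.mem_univ, if_true, horbit, Finset.sum_const,
    Finset.card_univ, nsmul_eq_mul, hΛ, hΘ, constant]
  have h0 : (Nat.card H : ℝ) ≠ 0 := by linarith
  have k0 : (Nat.card N : ℝ) ≠ 0 := by linarith
  field_simp
  ring

omit [Fintype (G ⧸ N →* ℂ)] [Fintype (N →* ℂ)] in
/-- The diagonal of `ZA(N ⋊ H)`, expanded in irreducible characters. -/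
theorem exists_diagonal_ZA (hF : IsFrobeniusDecomposition N H) :
    ∃ ω : ZA G ⊗[ℂ] ZA G,
      (∀ x y, tensorEval (centralFourierEquiv G) x y ω = if IsConj x y then 1 else 0) ∧
      projectiveNorm ω ≤ constant (Nat.card H) (Nat.card N) := by
  obtain ⟨_, hcardQ, hsumQ⟩ := exists_characterFintype (A := G ⧸ N) fun a b => by
    induction a using QuotientGroup.induction_on
    induction b using QuotientGroup.induction_on
    exact hF.mk_mul_comm _ _
  obtain ⟨_, hcard, hsum⟩ := exists_characterFintype (A := N) fun a b =>
    Subtype.ext (hF.comm_left a a.2 b b.2)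
  let e := centralFourierEquiv G
  let c : ℝ := (Nat.card H * Nat.card N) ^ 2
  have hc : 0 < c := pow_pos (mul_pos (Nat.cast_pos.2 Nat.card_pos) (Nat.cast_pos.2 Nat.card_pos)) 2
  let J := (G ⧸ N →* ℂ) ⊕ {θ : N →* ℂ // θ ≠ 1}
  let a : J × J → ZA G := fun p => ((irrCoeff N H p.1 p.2 / c : ℝ) : ℂ) • e.symm (hF.irrChar p.1)
  let b : J × J → ZA G := fun p => e.symm (classFunctionInv (hF.irrChar p.2))
  refine ⟨∑ p, a p ⊗ₜ b p, fun x y => ?_, (projectiveNorm_sum_tmul_le a b).trans ?_⟩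
  · have h := hF.sum_irrCoeff_mul_irrChar hcardQ hsumQ hcard hsum x y
    have hc' : (c : ℂ) ≠ 0 := Complex.ofReal_ne_zero.2 hc.ne'
    have hcc : (c : ℂ) = (Nat.card H * Nat.card N) ^ 2 := by push_cast [c]; rfl
    rw [← hcc] at h
    rw [← mul_right_inj' hc', ← h, map_sum, Fintype.sum_prod_type, Finset.mul_sum]
    refine Finset.sum_congr rfl fun i _ => ?_
    rw [Finset.mul_sum]
    refine Finset.sum_congr rfl fun j _ => ?_
    rw [tensorEval_tmul]
    simp only [a, b, e, map_smul, LinearEquiv.apply_symm_apply, Submodule.coe_smul, Pi.smul_apply,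
      smul_eq_mul, Complex.ofReal_div]
    field_simp
  · have h := hF.sum_irrCoeff_mul_irrDegree hcardQ hcard
    rw [← mul_le_mul_iff_right₀ hc, ← h, Fintype.sum_prod_type, Finset.mul_sum]
    refine Finset.sum_le_sum fun i _ => ?_
    rw [Finset.mul_sum]
    refine Finset.sum_le_sum fun j _ => ?_
    simp only [a, b, norm_smul, Complex.norm_real, Real.norm_eq_abs, abs_div, abs_of_pos hc]
    have h1 : ‖e.symm (hF.irrChar i)‖ ≤ irrDegree N H i := hF.fourierNorm_irrChar_le i
    have h2 : ‖e.symm (classFunctionInv (hF.irrChar j))‖ ≤ irrDegree N H j :=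
      hF.fourierNorm_irrChar_inv_le j
    calc _ = |irrCoeff N H i j| * (‖e.symm (hF.irrChar i)‖ *
          ‖e.symm (classFunctionInv (hF.irrChar j))‖) := by field_simp
      _ ≤ _ := by
        gcongr
        exact (norm_nonneg _).trans h1

end IsFrobeniusDecomposition

end DiagonalOfZA

/-! ### The common value of the two amenability constants. -/

theorem theorem2p2 {G : Type u} [Group G] [Fintype G] (H : Subgroup G)
    (hG : IsFrobeniusComplement H)
    (hK : ∀ a ∈ frobeniusKernel H, ∀ b ∈ frobeniusKernel H, a * b = b * a)
    (hH : ∀ a ∈ H, ∀ b ∈ H, a * b = b * a)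
    (k h : ℕ) (hk : Nat.card (frobeniusKernel H) = k) (hh : Nat.card H = h) :
    amenabilityConstant (ZA G) = amenabilityConstant (ZL1 G) ∧
    amenabilityConstant (ZL1 G) = ENNReal.ofReal
      (1 + 2 * ((h : ℝ) ^ 2 - 1) / h * (1 - ((h : ℝ) - 1) / k) * (1 - 1 / (k : ℝ))) := by
  obtain ⟨N, hN, _, hF⟩ := hG.exists_decomposition hK hH
  obtain ⟨ω, hω, hV⟩ := hF.exists_diagonal_ZA
  rw [← hN] at hk
  subst hk hh
  exact ⟨(hF.amenabilityConstant_ZA_eq ω hω hV).trans hF.amenabilityConstant_ZL1_eq.symm,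
    hF.amenabilityConstant_ZL1_eq⟩
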